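/- Let $N\ge 1$, let $\Omega\subset\mathbb{R}^N$ be a bounded open set with Lipschitz boundary (not necessarily connected), i.e. near each boundary point $\Omega$ is, after a rotation, the region strictly above the graph of a Lipschitz function of $N-1$ variables. Let $f\in L^1(\Omega)$ satisfy $f>0$ almost everywhere in $\Omega$. Then for every $\varepsilon>0$ there exists a constant $C(\varepsilon)>0$ (which may also depend on $\Omega$ and $f$) such that every $u\in H^1(\Omega)$ has a trace on $\partial\Omega$ in $L^2(\partial\Omega)$, and $$\int_{\partial\Omega} u^2\,d\sigma\le \varepsilon\int_\Omega|\nabla u|^2\,dx+C(\varepsilon)\int_\Omega f\,u^2\,dx .$$ Here $\sigma$ is the $(N-1)$-dimensional surface (Hausdorff) measure; on $\partial\Omega$ the function $u$ is understood as its trace, that is, the $L^2(\partial\Omega)$-limit of $\varphi_n|_{\partial\Omega}$ for any sequence $\varphi_n\in C^\infty(\mathbb{R}^N)$ which converges to $u$ in $H^1(\Omega)$ and whose restrictions to $\partial\Omega$ converge in $L^2(\partial\Omega)$; and the last integral takes values in $[0,+\infty]$, the inequality being trivially true when it equals $+\infty$. -/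

import Mathlib

open MeasureTheory Filter Topology
open scoped ContDiff RealInnerProductSpace ENNReal

/-- Euclidean `N`-space. -/
abbrev RN (N : ℕ) : Type := EuclideanSpace ℝ (Fin N)

/-- `Ω` is an open set with Lipschitz boundary: near each boundary point `x` there are a direction
`e` and a Lipschitz function `γ` on the hyperplane orthogonal to `e` such that, in a ball around
`x`, the set `Ω` is exactly the region lying strictly above the graph of `γ` in the direction `e`.
No connectedness is required. -/
structure IsLipschitzDomain {N : ℕ} (Ω : Set (RN N)) : Prop where
  isOpen : IsOpen Ω
  exists_graph : ∀ x ∈ frontier Ω, ∃ r : ℝ, 0 < r ∧ ∃ e : RN N, ‖e‖ = 1 ∧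
    ∃ (K : NNReal) (γ : (ℝ ∙ e)ᗮ → ℝ), LipschitzWith K γ ∧
      ∀ y ∈ Metric.ball x r, y ∈ Ω ↔ γ ((ℝ ∙ e)ᗮ.orthogonalProjectionOnto y) < ⟪e, y⟫

/-- `G` is a weak (distributional) gradient of `u` in the open set `Ω`:
`∫_Ω u ∇φ = - ∫_Ω φ G` for all test functions `φ ∈ C_c^∞(Ω)`. -/
structure HasWeakGradient {N : ℕ} (Ω : Set (RN N)) (u : RN N → ℝ) (G : RN N → RN N) : Prop where
  locallyIntegrable : LocallyIntegrableOn u Ω volume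
  locallyIntegrable_grad : LocallyIntegrableOn G Ω volume
  integral_eq : ∀ φ : RN N → ℝ, ContDiff ℝ ∞ φ → HasCompactSupport φ → tsupport φ ⊆ Ω →
    ∫ x in Ω, u x • gradient φ x = - ∫ x in Ω, φ x • G x

/-- `u ∈ H¹(Ω)`: `u ∈ L²(Ω)` and `u` has a weak gradient in `L²(Ω)`. -/
def MemH1 {N : ℕ} (Ω : Set (RN N)) (u : RN N → ℝ) : Prop :=
  MemLp u 2 (volume.restrict Ω) ∧
    ∃ G : RN N → RN N, HasWeakGradient Ω u G ∧ MemLp G 2 (volume.restrict Ω)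

/-- The surface measure `σ` on `∂Ω`: the `(N-1)`-dimensional Hausdorff measure, normalised to agree
with Lebesgue measure on hyperplanes, restricted to the boundary. -/
noncomputable def surfaceMeasure {N : ℕ} (Ω : Set (RN N)) : Measure (RN N) :=
  (Measure.euclideanHausdorffMeasure (N - 1)).restrict (frontier Ω)

/-- `g ∈ L²(∂Ω)` is the trace on `∂Ω` of `u`, a function on `Ω`: there are functions `φ n`, smooth
up to the boundary, with `φ n → u` in `H¹(Ω)` and `φ n → g` on the boundary in `L²(∂Ω)`.
This is the graph of the continuous extension to `H¹(Ω)` of the restriction map `φ ↦ φ|_∂Ω`. -/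
def IsTrace {N : ℕ} (Ω : Set (RN N)) (u g : RN N → ℝ) : Prop :=
  MemLp g 2 (surfaceMeasure Ω) ∧
    ∃ (G : RN N → RN N) (φ : ℕ → RN N → ℝ), HasWeakGradient Ω u G ∧
      (∀ n, ContDiff ℝ ∞ (φ n)) ∧
      Tendsto (fun n => eLpNorm (fun x => φ n x - u x) 2 (volume.restrict Ω)) atTop (𝓝 0) ∧
      Tendsto (fun n => eLpNorm (fun x => gradient (φ n) x - G x) 2 (volume.restrict Ω))
        atTop (𝓝 0) ∧
      Tendsto (fun n => eLpNorm (fun x => φ n x - g x) 2 (surfaceMeasure Ω)) atTop (𝓝 0)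

/-! The weight may be arbitrarily small on parts of Ω, and the gradient term has to pay for this.
Instead of a contradiction argument with Rellich compactness, two direct estimates for C¹ functions
are used, each with an arbitrarily small factor η in front of ∫_Ω |∇φ|².

Trace estimate (`exists_trace_le`): ∫_∂Ω φ² ≤ η ∫_Ω |∇φ|² + C ∫_Ω φ², from short segments entering Ω
at the boundary. Uniform integrability (`exists_uniform_integrability`): ∫_{B∩Ω} φ² ≤ η ∫_Ω |∇φ|² +
C |B| ∫_Ω φ², from averages over cones inside Ω.

Take B = {f ≤ s}. Since f > 0 a.e. and |Ω| < ∞, |B ∩ Ω| is small for small s, so the last term is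
absorbed on the left; off B, u² ≤ s⁻¹ f u². This bounds ∫_Ω u² by a small multiple of ∫_Ω |∇u|² plus
C ∫_Ω f u² (`lintegral_sq_le_weighted`), and the bound is inserted into the trace estimate.

The passage to H¹ rests on density of smooth functions (`exists_smooth_approx`), obtained by
convolution with kernels shifted into the cone. The trace estimate applied to differences makes the
boundary values Cauchy, so a trace exists. -/

/-! ### Elementary square inequalities -/

theorem ENNReal.add_sq_le_two_mul (a b : ℝ≥0∞) : (a + b) ^ 2 ≤ 2 * a ^ 2 + 2 * b ^ 2 := by
  have h := ENNReal.rpow_add_le_mul_rpow_add_rpow a b (p := 2) (by norm_num)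
  have e : (2 : ℝ) - 1 = 1 := by norm_num
  rw [e, ENNReal.rpow_one, mul_add] at h
  exact_mod_cast h

theorem MeasureTheory.eLpNorm_two_sq {α E : Type*} [MeasurableSpace α] [NormedAddCommGroup E]
    (f : α → E) (μ : Measure α) : eLpNorm f 2 μ ^ 2 = ∫⁻ x, ‖f x‖ₑ ^ 2 ∂μ := by
  have h := eLpNorm_nnreal_pow_eq_lintegral (f := f) (μ := μ) (p := 2) (by norm_num)
  have e : ((2 : NNReal) : ℝ) = ((2 : ℕ) : ℝ) := by norm_num
  simpa only [e, ENNReal.rpow_natCast, ENNReal.coe_ofNat] using h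

/-- The Cauchy-Schwarz inequality against a constant. -/
theorem MeasureTheory.sq_lintegral_le {α : Type*} [MeasurableSpace α] (μ : Measure α)
    {f : α → ℝ≥0∞} (hf : AEMeasurable f μ) :
    (∫⁻ x, f x ∂μ) ^ 2 ≤ μ Set.univ * ∫⁻ x, f x ^ 2 ∂μ := by
  have h := ENNReal.lintegral_mul_le_Lp_mul_Lq μ Real.HolderConjugate.two_two hf
    (aemeasurable_const (b := (1 : ℝ≥0∞)))
  simp only [Pi.mul_apply, mul_one, ENNReal.one_rpow, lintegral_const, one_mul] at h
  calc (∫⁻ x, f x ∂μ) ^ 2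
      ≤ ((∫⁻ x, f x ^ (2 : ℝ) ∂μ) ^ (1 / 2 : ℝ) * μ Set.univ ^ (1 / 2 : ℝ)) ^ 2 := by gcongr
    _ = μ Set.univ * ∫⁻ x, f x ^ 2 ∂μ := by
      rw [mul_pow, ← ENNReal.rpow_natCast, ← ENNReal.rpow_mul, ← ENNReal.rpow_natCast,
        ← ENNReal.rpow_mul, mul_comm]
      norm_num

/-! ### Integration along segments -/

section

variable {E : Type*} [NormedAddCommGroup E] [InnerProductSpace ℝ E] [CompleteSpace E]

theorem ContDiff.continuous_gradient {φ : E → ℝ} (hφ : ContDiff ℝ 1 φ) :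
    Continuous (gradient φ) :=
  (InnerProductSpace.toDual ℝ E).symm.continuous.comp (hφ.continuous_fderiv one_ne_zero)

/-- Fundamental theorem of calculus along the segment, then Cauchy-Schwarz; the factor t is the
length of the parameter interval. Every later estimate averages this one over endpoints. -/
theorem ContDiff.enorm_sq_le_along_segment {φ : E → ℝ} (hφ : ContDiff ℝ 1 φ) (x v : E) {t : ℝ}
    (ht : 0 ≤ t) :
    ‖φ x‖ₑ ^ 2 ≤ 2 * ‖φ (x + t • v)‖ₑ ^ 2 + 2 * (ENNReal.ofReal t * ‖v‖ₑ ^ 2 *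
      ∫⁻ τ in Set.Ioc 0 t, ‖gradient φ (x + τ • v)‖ₑ ^ 2) := by
  have hcg : Continuous fun τ : ℝ => gradient φ (x + τ • v) :=
    hφ.continuous_gradient.comp (by fun_prop)
  have hder : ∀ τ : ℝ, HasDerivAt (fun τ : ℝ => φ (x + τ • v)) ⟪gradient φ (x + τ • v), v⟫ τ := by
    intro τ
    have h1 : HasFDerivAt φ (InnerProductSpace.toDual ℝ E (gradient φ (x + τ • v))) (x + τ • v) :=
      (hφ.differentiable one_ne_zero _).hasGradientAt.hasFDerivAt
    have h2 : HasDerivAt (fun τ : ℝ => x + τ • v) v τ := by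
      simpa using! ((hasDerivAt_id τ).smul_const v).const_add x
    simpa using! h1.comp_hasDerivAt τ h2
  have hint : ∫ τ in (0 : ℝ)..t, ⟪gradient φ (x + τ • v), v⟫ = φ (x + t • v) - φ x := by
    rw [intervalIntegral.integral_eq_sub_of_hasDerivAt (fun τ _ => hder τ)
      ((hcg.inner continuous_const).intervalIntegrable _ _)]
    simp
  have hdiff : ‖φ (x + t • v) - φ x‖ₑ ≤
      ∫⁻ τ in Set.Ioc 0 t, ‖gradient φ (x + τ • v)‖ₑ * ‖v‖ₑ := by
    rw [← hint, intervalIntegral.integral_of_le ht]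
    refine (enorm_integral_le_lintegral_enorm _).trans (lintegral_mono fun τ => ?_)
    simp only [← ofReal_norm, ← ENNReal.ofReal_mul (norm_nonneg _)]
    exact ENNReal.ofReal_le_ofReal (norm_inner_le_norm _ _)
  calc ‖φ x‖ₑ ^ 2 = ‖φ (x + t • v) - (φ (x + t • v) - φ x)‖ₑ ^ 2 := by congr 2; ring
    _ ≤ (‖φ (x + t • v)‖ₑ + ‖φ (x + t • v) - φ x‖ₑ) ^ 2 := by gcongr; exact enorm_sub_le
    _ ≤ 2 * ‖φ (x + t • v)‖ₑ ^ 2 + 2 * ‖φ (x + t • v) - φ x‖ₑ ^ 2 := ENNReal.add_sq_le_two_mul _ _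
    _ ≤ 2 * ‖φ (x + t • v)‖ₑ ^ 2 + 2 * (volume.restrict (Set.Ioc 0 t) Set.univ *
        ∫⁻ τ in Set.Ioc 0 t, (‖gradient φ (x + τ • v)‖ₑ * ‖v‖ₑ) ^ 2) := by
      gcongr
      refine le_trans (by gcongr) (sq_lintegral_le _ ?_)
      exact (hcg.enorm.measurable.mul_const _).aemeasurable
    _ = _ := by
      simp only [mul_pow]
      rw [lintegral_mul_const' _ _ (by simp)]
      simp only [Measure.restrict_apply_univ, Real.volume_Ioc, sub_zero]
      ring

end

/-! ### Cones and graphs at the boundary -/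

namespace IsLipschitzDomain

variable {N : ℕ} {Ω : Set (RN N)}

/-- A step t • v raises the height ⟪e, ·⟫ by at least t(1 - ‖v - e‖), while the graph below rises by
at most K t ‖v - e‖; for v near e the point stays above the graph. -/
theorem exists_cone (hΩ : IsLipschitzDomain Ω) {x₀ : RN N} (hx₀ : x₀ ∈ closure Ω) :
    ∃ r : ℝ, 0 < r ∧ ∃ (e : RN N) (κ : ℝ), 0 < κ ∧ ∀ x ∈ Ω, dist x x₀ < r →
      ∀ t : ℝ, 0 < t → t < r → ∀ v ∈ Metric.ball e κ, x + t • v ∈ Ω := by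
  by_cases hx : x₀ ∈ Ω
  · obtain ⟨r, hr, hball⟩ := Metric.isOpen_iff.1 hΩ.isOpen x₀ hx
    -- At an interior point every direction is allowed: the cone is generated by the unit ball
    -- around 0.
    refine ⟨r / 2, by positivity, 0, 1, one_pos, fun x _ hxr t ht htr v hv => hball ?_⟩
    rw [Metric.mem_ball, dist_eq_norm] at *
    have h1 : ‖t • v‖ ≤ t := by
      rw [norm_smul, Real.norm_of_nonneg ht.le]
      exact mul_le_of_le_one_right ht.le (by simpa using hv.le)
    calc ‖x + t • v - x₀‖ = ‖(x - x₀) + t • v‖ := by congr 1; abel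
      _ ≤ ‖x - x₀‖ + ‖t • v‖ := norm_add_le _ _
      _ < r := by linarith
  · have hfr : x₀ ∈ frontier Ω := ⟨hx₀, by rwa [hΩ.isOpen.interior_eq]⟩
    obtain ⟨r, hr, e, he, K, γ, hγ, hgraph⟩ := hΩ.exists_graph x₀ hfr
    have hK : (0 : ℝ) ≤ K := K.2
    -- This κ satisfies (1 + K) κ < 1, which gives K ‖v - e‖ < 1 - ‖v - e‖.
    have hκ : (0 : ℝ) < 1 / (2 + K) := by positivity
    have hκ2 : (2 + (K : ℝ)) * (1 / (2 + K)) = 1 := by field_simp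
    set κ : ℝ := 1 / (2 + K)
    have hκ1 : κ ≤ 1 := by nlinarith
    refine ⟨r / 4, by positivity, e, κ, hκ, fun x hxΩ hxr t ht htr v hv => ?_⟩
    rw [Metric.mem_ball, dist_eq_norm] at hv
    have hv2 : ‖v‖ ≤ 2 := by
      calc ‖v‖ = ‖(v - e) + e‖ := by simp
        _ ≤ ‖v - e‖ + ‖e‖ := norm_add_le _ _
        _ ≤ 2 := by linarith
    have hmem : x ∈ Metric.ball x₀ r := by rw [Metric.mem_ball]; linarith
    have hmem' : x + t • v ∈ Metric.ball x₀ r := by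
      rw [Metric.mem_ball, dist_eq_norm]
      rw [dist_eq_norm] at hxr
      calc ‖x + t • v - x₀‖ = ‖(x - x₀) + t • v‖ := by congr 1; abel
        _ ≤ ‖x - x₀‖ + ‖t • v‖ := norm_add_le _ _
        _ = ‖x - x₀‖ + t * ‖v‖ := by rw [norm_smul, Real.norm_of_nonneg ht.le]
        _ < r := by nlinarith
    rw [hgraph _ hmem']
    have hx1 := (hgraph _ hmem).1 hxΩ
    set P := (ℝ ∙ e)ᗮ.orthogonalProjectionOnto
    have hPe : P e = 0 :=
      Submodule.orthogonalProjectionOnto_orthogonalComplement_singleton_eq_zero e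
    have hPv : ‖P v‖ ≤ ‖v - e‖ := by
      have : P v = P (v - e) := by rw [map_sub, hPe, sub_zero]
      rw [this]
      exact Submodule.norm_orthogonalProjectionOnto_apply_le _ _
    have hγ' : γ (P (x + t • v)) ≤ γ (P x) + K * (t * ‖v - e‖) := by
      have h := hγ.dist_le_mul (P (x + t • v)) (P x)
      rw [Real.dist_eq, dist_eq_norm, map_add, add_sub_cancel_left, map_smul, norm_smul,
        Real.norm_of_nonneg ht.le] at h
      have h2 := (abs_le.1 h).2
      have h3 : K * (t * ‖P v‖) ≤ K * (t * ‖v - e‖) := by gcongr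
      rw [map_add, map_smul]
      linarith
    have hinner : 1 - ‖v - e‖ ≤ ⟪e, v⟫ := by
      have h1 : ⟪e, v⟫ = 1 + ⟪e, v - e⟫ := by
        rw [inner_sub_right, real_inner_self_eq_norm_sq, he]; ring
      have h2 := (abs_le.1 (abs_real_inner_le_norm e (v - e))).1
      rw [he, one_mul] at h2
      linarith
    rw [inner_add_right, real_inner_smul_right]
    have h5 : K * ‖v - e‖ < ⟪e, v⟫ := by nlinarith
    nlinarith

/-- A boundary point is not in the open set Ω, so it is not strictly above the graph; as a limit of
points of Ω it is not below. Moving it up by e then enters Ω. -/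
theorem exists_graph_frontier (hΩ : IsLipschitzDomain Ω) {x₀ : RN N} (hx₀ : x₀ ∈ frontier Ω) :
    ∃ s : ℝ, 0 < s ∧ ∃ e : RN N, ‖e‖ = 1 ∧ ∃ (K : NNReal) (γ : (ℝ ∙ e)ᗮ → ℝ), LipschitzWith K γ ∧
      ∀ x ∈ frontier Ω, dist x x₀ < s →
        γ ((ℝ ∙ e)ᗮ.orthogonalProjectionOnto x) = ⟪e, x⟫ ∧ ∀ t : ℝ, 0 < t → t < s → x + t • e ∈ Ω := by
  obtain ⟨r, hr, e, he, K, γ, hγ, hgraph⟩ := hΩ.exists_graph x₀ hx₀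
  refine ⟨r / 2, by positivity, e, he, K, γ, hγ, fun x hx hxr => ?_⟩
  set P := (ℝ ∙ e)ᗮ.orthogonalProjectionOnto
  have hxb : x ∈ Metric.ball x₀ r := by rw [Metric.mem_ball]; linarith
  have hxΩ : x ∉ Ω := by
    have := hx.2
    rwa [hΩ.isOpen.interior_eq] at this
  have h1 : ⟪e, x⟫ ≤ γ (P x) := not_lt.1 fun h => hxΩ ((hgraph x hxb).2 h)
  have h2 : γ (P x) ≤ ⟪e, x⟫ := by
    have hcl : x ∈ closure (Ω ∩ Metric.ball x₀ r) := by
      have := Metric.isOpen_ball.inter_closure (t := Ω) ⟨hxb, hx.1⟩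
      rwa [Set.inter_comm] at this
    have hclosed : IsClosed {y | γ (P y) ≤ ⟪e, y⟫} :=
      isClosed_le (hγ.continuous.comp P.continuous) (by fun_prop)
    exact closure_minimal (fun y hy => ((hgraph y hy.2).1 hy.1).le) hclosed hcl
  refine ⟨le_antisymm h2 h1, fun t ht hts => ?_⟩
  have hmem' : x + t • e ∈ Metric.ball x₀ r := by
    rw [Metric.mem_ball, dist_eq_norm]
    rw [dist_eq_norm] at hxr
    calc ‖x + t • e - x₀‖ = ‖(x - x₀) + t • e‖ := by congr 1; abel
      _ ≤ ‖x - x₀‖ + ‖t • e‖ := norm_add_le _ _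
      _ = ‖x - x₀‖ + t := by rw [norm_smul, Real.norm_of_nonneg ht.le, he, mul_one]
      _ < r := by linarith
  have hPe : P e = 0 :=
    Submodule.orthogonalProjectionOnto_orthogonalComplement_singleton_eq_zero e
  rw [hgraph _ hmem', map_add, map_smul, hPe, smul_zero, add_zero, inner_add_right,
    real_inner_smul_right, real_inner_self_eq_norm_sq, he]
  linarith

end IsLipschitzDomain

/-! ### Uniform integrability by averaging over cones -/

theorem setLIntegral_comp_le_of_mapsTo {G α : Type*} [MeasurableSpace G] [MeasurableSpace α]
    {μ : Measure G} {ν : Measure α} {T : α → G} (hT : MeasurePreserving T ν μ) {A : Set α}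
    {Ω : Set G} (hA : MeasurableSet A) (hΩ : MeasurableSet Ω) {h : G → ℝ≥0∞} (hh : Measurable h)
    (hmaps : Set.MapsTo T A Ω) : ∫⁻ x in A, h (T x) ∂ν ≤ ∫⁻ x in Ω, h x ∂μ := by
  calc ∫⁻ x in A, h (T x) ∂ν ≤ ∫⁻ x in A, Ω.indicator h (T x) ∂ν :=
        setLIntegral_mono' hA fun x hx => by rw [Set.indicator_of_mem (hmaps hx)]
    _ ≤ ∫⁻ x, Ω.indicator h (T x) ∂ν := setLIntegral_le_lintegral _ _
    _ = ∫⁻ x in Ω, h x ∂μ := by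
      rw [hT.lintegral_comp (hh.indicator hΩ), lintegral_indicator hΩ]

namespace IsLipschitzDomain

variable {N : ℕ} {Ω : Set (RN N)}

/-- Average the segment estimate over x + w, w ∈ W, with W a ball in the cone. The values at the
endpoints contribute at most 2|W|⁻¹ ∫_Ω φ² at each x, hence a factor |B| after integration. In the
gradient term, Tonelli allows integrating in x first for fixed (w, τ), where x ↦ x + τ w is a
translation into Ω; no singular kernel appears. -/
theorem exists_local_uniform_integrability (hΩ : IsLipschitzDomain Ω) {x₀ : RN N}
    (hx₀ : x₀ ∈ closure Ω) :
    ∃ r : ℝ, 0 < r ∧ ∀ η : ℝ≥0∞, η ≠ 0 → ∃ C : ℝ≥0∞, C ≠ ⊤ ∧ ∀ φ : RN N → ℝ, ContDiff ℝ 1 φ →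
      ∀ B : Set (RN N), ∫⁻ x in B ∩ (Ω ∩ Metric.ball x₀ r), ‖φ x‖ₑ ^ 2 ≤
        η * (∫⁻ x in Ω, ‖gradient φ x‖ₑ ^ 2) + C * volume B * ∫⁻ x in Ω, ‖φ x‖ₑ ^ 2 := by
  obtain ⟨r, hr, e, κ, hκ, hcone⟩ := hΩ.exists_cone hx₀
  refine ⟨r, hr, fun η hη => ?_⟩
  set M : ℝ := ‖e‖ + κ
  -- Vectors of W have norm at most t M, so 2 (t M)² will be the gradient coefficient.
  obtain ⟨t, ht, htr, htη⟩ : ∃ t : ℝ, 0 < t ∧ t < r ∧ 2 * ENNReal.ofReal (t * M) ^ 2 ≤ η := by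
    have hlim : Tendsto (fun t : ℝ => 2 * ENNReal.ofReal (t * M) ^ 2) (𝓝[>] 0) (𝓝 0) := by
      have h0 : Tendsto (fun t : ℝ => ENNReal.ofReal (t * M)) (𝓝 0) (𝓝 0) := by
        have : Continuous fun t : ℝ => ENNReal.ofReal (t * M) :=
          ENNReal.continuous_ofReal.comp (by fun_prop)
        simpa using this.tendsto 0
      have h1 := ENNReal.Tendsto.const_mul (a := 2) (ENNReal.Tendsto.pow (n := 2) h0) (Or.inr (by simp))
      simp only [ne_eq, OfNat.ofNat_ne_zero, not_false_eq_true, zero_pow, mul_zero] at h1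
      exact h1.mono_left nhdsWithin_le_nhds
    obtain ⟨t, h1, h2, h3⟩ := ((hlim.eventually_le_const (pos_iff_ne_zero.2 hη)).and
      (Ioo_mem_nhdsGT hr)).exists
    exact ⟨t, h2, h3, h1⟩
  -- W is t times the ball of cone directions, so the whole segment from x ∈ D to x + w stays in Ω.
  set W : Set (RN N) := Metric.ball (t • e) (t * κ) with hW
  have hW0 : volume W ≠ 0 := (Metric.measure_ball_pos _ _ (by positivity)).ne'
  have hWtop : volume W ≠ ⊤ := measure_ball_lt_top.ne
  set D : Set (RN N) := Ω ∩ Metric.ball x₀ r with hD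
  have hDm : MeasurableSet D := (hΩ.isOpen.inter Metric.isOpen_ball).measurableSet
  have hmem : ∀ x ∈ D, ∀ w ∈ W, ∀ τ ∈ Set.Ioc (0 : ℝ) 1, x + τ • w ∈ Ω := by
    intro x hx w hw τ hτ
    have hv : t⁻¹ • w ∈ Metric.ball e κ := by
      rw [hW, Metric.mem_ball, dist_eq_norm] at hw
      rw [Metric.mem_ball, dist_eq_norm]
      have : t⁻¹ • w - e = t⁻¹ • (w - t • e) := by
        rw [smul_sub, smul_smul, inv_mul_cancel₀ ht.ne', one_smul]
      rw [this, norm_smul, norm_inv, Real.norm_of_nonneg ht.le, inv_mul_lt_iff₀ ht]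
      exact hw
    have h := hcone x hx.1 hx.2 (τ * t) (mul_pos hτ.1 ht) (by nlinarith [hτ.2]) _ hv
    rwa [smul_smul, mul_assoc, mul_inv_cancel₀ ht.ne', mul_one] at h
  have hWM : ∀ w ∈ W, ‖w‖ₑ ≤ ENNReal.ofReal (t * M) := by
    intro w hw
    rw [hW, Metric.mem_ball, dist_eq_norm] at hw
    rw [← ofReal_norm]
    apply ENNReal.ofReal_le_ofReal
    calc ‖w‖ = ‖(w - t • e) + t • e‖ := by simp
      _ ≤ ‖w - t • e‖ + ‖t • e‖ := norm_add_le _ _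
      _ ≤ t * κ + t * ‖e‖ := by rw [norm_smul, Real.norm_of_nonneg ht.le]; gcongr
      _ = t * M := by ring
  refine ⟨2 * (volume W)⁻¹, ENNReal.mul_ne_top (by simp) (by simpa using hW0), fun φ hφ B => ?_⟩
  set I := ∫⁻ x in Ω, ‖φ x‖ₑ ^ 2
  set J := ∫⁻ x in Ω, ‖gradient φ x‖ₑ ^ 2
  set ν : Measure (RN N × ℝ) := (volume.restrict W).prod (volume.restrict (Set.Ioc (0 : ℝ) 1))
    with hν
  have hcφ : Continuous φ := hφ.continuous
  have hcg := hφ.continuous_gradient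
  have hνuniv : ν Set.univ = volume W := by
    rw [hν, ← Set.univ_prod_univ, Measure.prod_prod]; simp
  have hpt : ∀ x ∈ D, volume W * ‖φ x‖ₑ ^ 2 ≤ 2 * I + 2 * (ENNReal.ofReal (t * M) ^ 2 *
      ∫⁻ p, ‖gradient φ (x + p.2 • p.1)‖ₑ ^ 2 ∂ν) := by
    intro x hx
    have hmeas : Measurable fun p : RN N × ℝ => ‖gradient φ (x + p.2 • p.1)‖ₑ ^ 2 := by
      have : Continuous fun p : RN N × ℝ => gradient φ (x + p.2 • p.1) := hcg.comp (by fun_prop)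
      exact this.enorm.measurable.pow_const 2
    calc volume W * ‖φ x‖ₑ ^ 2 = ∫⁻ _ in W, ‖φ x‖ₑ ^ 2 := by rw [setLIntegral_const, mul_comm]
      _ ≤ ∫⁻ w in W, (2 * ‖φ (x + w)‖ₑ ^ 2 + 2 * (ENNReal.ofReal (t * M) ^ 2 *
          ∫⁻ τ in Set.Ioc (0 : ℝ) 1, ‖gradient φ (x + τ • w)‖ₑ ^ 2)) := by
        refine setLIntegral_mono' measurableSet_ball fun w hw => ?_
        have h := hφ.enorm_sq_le_along_segment x w zero_le_one
        rw [one_smul, ENNReal.ofReal_one, one_mul] at h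
        refine h.trans ?_
        gcongr
        exact hWM w hw
      _ = 2 * (∫⁻ w in W, ‖φ (x + w)‖ₑ ^ 2) + 2 * (ENNReal.ofReal (t * M) ^ 2 *
          ∫⁻ p, ‖gradient φ (x + p.2 • p.1)‖ₑ ^ 2 ∂ν) := by
        rw [lintegral_add_left, lintegral_const_mul' _ _ (by simp), lintegral_const_mul' _ _ (by simp),
          lintegral_const_mul' _ _ (by simp), hν, lintegral_prod _ hmeas.aemeasurable]
        have : Continuous fun w => φ (x + w) := hcφ.comp (by fun_prop)
        exact (this.enorm.measurable.pow_const 2).const_mul 2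
      _ ≤ _ := by
        gcongr
        refine setLIntegral_comp_le_of_mapsTo (measurePreserving_add_left volume x)
          measurableSet_ball hΩ.isOpen.measurableSet (hcφ.enorm.measurable.pow_const 2) fun w hw => ?_
        simpa using hmem x hx w hw 1 ⟨one_pos, le_rfl⟩
  have hswap : ∫⁻ x in D, ∫⁻ p, ‖gradient φ (x + p.2 • p.1)‖ₑ ^ 2 ∂ν ≤ volume W * J := by
    rw [lintegral_lintegral_swap]
    · have hae : ∀ᵐ p ∂ν, ∫⁻ x in D, ‖gradient φ (x + p.2 • p.1)‖ₑ ^ 2 ≤ J := by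
        rw [hν, Measure.prod_restrict]
        filter_upwards [ae_restrict_mem (measurableSet_ball.prod measurableSet_Ioc)] with p hp
        exact setLIntegral_comp_le_of_mapsTo (measurePreserving_add_right volume (p.2 • p.1))
          hDm hΩ.isOpen.measurableSet (hcg.enorm.measurable.pow_const 2)
          fun x hx => hmem x hx _ hp.1 _ hp.2
      calc _ ≤ ∫⁻ _, J ∂ν := lintegral_mono_ae hae
        _ = volume W * J := by rw [lintegral_const, hνuniv, mul_comm]
    · have : Continuous fun q : RN N × (RN N × ℝ) => gradient φ (q.1 + q.2.2 • q.2.1) :=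
        hcg.comp (by fun_prop)
      exact (this.enorm.measurable.pow_const 2).aemeasurable
  have hmain : volume W * ∫⁻ x in B ∩ D, ‖φ x‖ₑ ^ 2 ≤
      2 * I * volume B + 2 * (ENNReal.ofReal (t * M) ^ 2 * (volume W * J)) := by
    calc volume W * ∫⁻ x in B ∩ D, ‖φ x‖ₑ ^ 2
        = ∫⁻ x in B ∩ D, volume W * ‖φ x‖ₑ ^ 2 := (lintegral_const_mul' _ _ hWtop).symm
      _ ≤ ∫⁻ x in B ∩ D, (2 * I + 2 * (ENNReal.ofReal (t * M) ^ 2 *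
          ∫⁻ p, ‖gradient φ (x + p.2 • p.1)‖ₑ ^ 2 ∂ν)) := by
        refine lintegral_mono_ae ?_
        have : ∀ᵐ x ∂(volume.restrict (B ∩ D)), x ∈ D :=
          ae_restrict_of_ae_restrict_of_subset Set.inter_subset_right (ae_restrict_mem hDm)
        filter_upwards [this] with x hx using hpt x hx
      _ = 2 * I * volume (B ∩ D) + 2 * (ENNReal.ofReal (t * M) ^ 2 *
          ∫⁻ x in B ∩ D, ∫⁻ p, ‖gradient φ (x + p.2 • p.1)‖ₑ ^ 2 ∂ν) := by
        rw [lintegral_add_left measurable_const, setLIntegral_const,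
          lintegral_const_mul' _ _ (by simp), lintegral_const_mul' _ _ (by simp)]
      _ ≤ _ := by
        gcongr
        · exact Set.inter_subset_left
        · exact (lintegral_mono_set Set.inter_subset_right).trans hswap
  calc ∫⁻ x in B ∩ D, ‖φ x‖ₑ ^ 2
      = (volume W)⁻¹ * (volume W * ∫⁻ x in B ∩ D, ‖φ x‖ₑ ^ 2) := by
        rw [← mul_assoc, ENNReal.inv_mul_cancel hW0 hWtop, one_mul]
    _ ≤ (volume W)⁻¹ * (2 * I * volume B + 2 * (ENNReal.ofReal (t * M) ^ 2 * (volume W * J))) := by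
        gcongr
    _ = (volume W)⁻¹ * volume W * (2 * ENNReal.ofReal (t * M) ^ 2) * J +
        2 * (volume W)⁻¹ * volume B * I := by ring
    _ ≤ _ := by
        rw [ENNReal.inv_mul_cancel hW0 hWtop, one_mul]
        gcongr

theorem exists_uniform_integrability (hΩ : IsLipschitzDomain Ω) (hbdd : Bornology.IsBounded Ω)
    {η : ℝ≥0∞} (hη : η ≠ 0) :
    ∃ C : ℝ≥0∞, C ≠ ⊤ ∧ ∀ φ : RN N → ℝ, ContDiff ℝ 1 φ →
      ∀ B : Set (RN N), ∫⁻ x in B ∩ Ω, ‖φ x‖ₑ ^ 2 ≤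
        η * (∫⁻ x in Ω, ‖gradient φ x‖ₑ ^ 2) + C * volume B * ∫⁻ x in Ω, ‖φ x‖ₑ ^ 2 := by
  -- The quantifier over η is part of the induction predicate, so that a union can give η / 2 to
  -- each piece.
  have key := hbdd.isCompact_closure.induction_on (p := fun S => ∀ η : ℝ≥0∞, η ≠ 0 →
    ∃ C : ℝ≥0∞, C ≠ ⊤ ∧ ∀ φ : RN N → ℝ, ContDiff ℝ 1 φ →
      ∀ B : Set (RN N), ∫⁻ x in B ∩ (Ω ∩ S), ‖φ x‖ₑ ^ 2 ≤
        η * (∫⁻ x in Ω, ‖gradient φ x‖ₑ ^ 2) + C * volume B * ∫⁻ x in Ω, ‖φ x‖ₑ ^ 2)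
    (fun η _ => ⟨0, by simp, fun φ _ B => by simp⟩) ?_ ?_ ?_ η hη
  · obtain ⟨C, hC, h⟩ := key
    refine ⟨C, hC, fun φ hφ B => ?_⟩
    have := h φ hφ B
    rwa [Set.inter_eq_left.2 subset_closure] at this
  · intro s t hst ht η hη
    obtain ⟨C, hC, h⟩ := ht η hη
    refine ⟨C, hC, fun φ hφ B => (lintegral_mono_set ?_).trans (h φ hφ B)⟩
    gcongr
  · intro s t hs ht η hη
    obtain ⟨C, hC, h⟩ := hs (η / 2) (by simpa using hη)
    obtain ⟨C', hC', h'⟩ := ht (η / 2) (by simpa using hη)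
    refine ⟨C + C', by simp [hC, hC'], fun φ hφ B => ?_⟩
    rw [Set.inter_union_distrib_left, Set.inter_union_distrib_left]
    refine (lintegral_union_le _ _ _).trans ((add_le_add (h φ hφ B) (h' φ hφ B)).trans_eq ?_)
    conv_rhs => rw [← ENNReal.add_halves η]
    ring
  · intro x hx
    obtain ⟨r, hr, h⟩ := hΩ.exists_local_uniform_integrability hx
    exact ⟨Metric.ball x r, mem_nhdsWithin_of_mem_nhds (Metric.ball_mem_nhds x hr), h⟩

end IsLipschitzDomain

/-! ### Boundary collars and the trace estimate -/

/-- Change of variables, as an inequality, for a Lipschitz parametrisation. -/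
theorem LipschitzWith.setLIntegral_euclideanHausdorffMeasure_le {X Y : Type*}
    [MetricSpace X] [MeasurableSpace X] [BorelSpace X]
    [MetricSpace Y] [MeasurableSpace Y] [BorelSpace Y] {K : NNReal} {f : X → Y}
    (hf : LipschitzWith K f) (d : ℕ) {S : Set Y} (hSf : S ⊆ Set.range f)
    {g : Y → ℝ≥0∞} (hg : Measurable g) :
    ∫⁻ y in S, g y ∂(Measure.euclideanHausdorffMeasure d) ≤
      (K : ℝ≥0∞) ^ d * ∫⁻ x in f ⁻¹' S, g (f x) ∂(Measure.euclideanHausdorffMeasure d) := by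
  have hfm : Measurable f := hf.continuous.measurable
  -- It suffices to compare measures: S lies in the range of f, so A ∩ S is the image of its
  -- preimage, and a K-Lipschitz map enlarges d-dimensional measure at most by K^d.
  have hle : (Measure.euclideanHausdorffMeasure d : Measure Y).restrict S ≤ ((K : ℝ≥0∞) ^ d) •
      Measure.map f ((Measure.euclideanHausdorffMeasure d : Measure X).restrict (f ⁻¹' S)) := by
    refine Measure.le_iff.2 fun A hA => ?_
    rw [Measure.restrict_apply hA, Measure.smul_apply, Measure.map_apply hfm hA,
      Measure.restrict_apply (hfm hA), ← Set.preimage_inter, smul_eq_mul]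
    have himg : A ∩ S = f '' (f ⁻¹' (A ∩ S)) := by
      rw [Set.image_preimage_eq_inter_range, Set.inter_eq_left.2 (Set.inter_subset_right.trans hSf)]
    conv_lhs => rw [himg]
    have h := hf.hausdorffMeasure_image_le (d := d) (Nat.cast_nonneg d) (f ⁻¹' (A ∩ S))
    rw [ENNReal.rpow_natCast] at h
    simp only [Measure.euclideanHausdorffMeasure_def, Measure.smul_apply, ENNReal.smul_def,
      smul_eq_mul]
    refine (mul_le_mul_right h _).trans_eq ?_
    ring
  calc _ ≤ _ := lintegral_mono' hle le_rfl
    _ = _ := by rw [lintegral_smul_measure, lintegral_map hg hfm, smul_eq_mul]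

section

variable {N : ℕ}

theorem finrank_orthogonal_span_singleton_of_norm_eq_one {e : RN N} (he : ‖e‖ = 1) :
    Module.finrank ℝ (ℝ ∙ e)ᗮ = N - 1 := by
  have h := Submodule.finrank_add_finrank_orthogonal (ℝ ∙ e)
  have he0 : e ≠ 0 := by rintro rfl; simp at he
  rw [finrank_span_singleton he0, finrank_euclideanSpace_fin] at h
  omega

theorem measurePreserving_add_smul {e : RN N} (he : ‖e‖ = 1) :
    MeasurePreserving (fun p : (ℝ ∙ e)ᗮ × ℝ => (p.1 : RN N) + p.2 • e)
      (volume.prod volume) volume := by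
  have h1 := ((ℝ ∙ e).measurePreserving_measurableEquivProd (0 : RN N)).symm
  rw [InnerProductSpace.euclideanHausdorffMeasure_eq_volume] at h1
  have h2 := (LinearIsometryEquiv.toSpanUnitSingleton (𝕜 := ℝ) e he).measurePreserving
  have h3 := h1.comp ((h2.prod (MeasurePreserving.id (volume : Measure (ℝ ∙ e)ᗮ))).comp
    (Measure.measurePreserving_swap (μ := (volume : Measure (ℝ ∙ e)ᗮ)) (ν := (volume : Measure ℝ))))
  convert! h3 using 1
  funext p
  simp [Submodule.measurableEquivProd_symm_apply, add_comm]

/-- Straightening the graph is a shear: a translation by γ y on each vertical line. -/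
theorem measurePreserving_graph {e : RN N} (he : ‖e‖ = 1) {γ : (ℝ ∙ e)ᗮ → ℝ} (hγ : Measurable γ) :
    MeasurePreserving (fun p : (ℝ ∙ e)ᗮ × ℝ => ((p.1 : RN N) + γ p.1 • e) + p.2 • e)
      (volume.prod volume) volume := by
  have h1 : MeasurePreserving (fun p : (ℝ ∙ e)ᗮ × ℝ => (p.1, γ p.1 + p.2))
      (volume.prod volume) (volume.prod volume) :=
    (MeasurePreserving.id (volume : Measure (ℝ ∙ e)ᗮ)).skew_product
      (g := fun y t => γ y + t) (by fun_prop)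
      (Eventually.of_forall fun y => (measurePreserving_add_left volume (γ y)).map_eq)
  convert! (measurePreserving_add_smul he).comp h1 using 1
  funext p
  simp [add_smul, add_assoc]

end

namespace IsLipschitzDomain

variable {N : ℕ} {Ω : Set (RN N)}

/-- The boundary piece is parametrised over a hyperplane by a (1 + K)-Lipschitz map, so surface
measure is at most (1 + K)^(N-1) times Lebesgue measure there, and no area formula is needed. Adding
the height τ gives a measure-preserving map into Ω. -/
theorem exists_collar (hΩ : IsLipschitzDomain Ω) {x₀ : RN N} (hx₀ : x₀ ∈ frontier Ω) :
    ∃ s : ℝ, 0 < s ∧ ∃ e : RN N, ‖e‖ = 1 ∧ ∃ c : ℝ≥0∞, c ≠ ⊤ ∧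
      ∀ h : RN N → ℝ≥0∞, Measurable h → ∀ t < s,
        ∫⁻ x in frontier Ω ∩ Metric.ball x₀ s, (∫⁻ τ in Set.Ioc 0 t, h (x + τ • e))
          ∂(Measure.euclideanHausdorffMeasure (N - 1)) ≤ c * ∫⁻ x in Ω, h x := by
  obtain ⟨s, hs, e, he, K, γ, hγ, hgraph⟩ := hΩ.exists_graph_frontier hx₀
  set P := (ℝ ∙ e)ᗮ.orthogonalProjectionOnto
  set Φ : (ℝ ∙ e)ᗮ → RN N := fun y => (y : RN N) + γ y • e
  have hΦ : LipschitzWith (1 + K) Φ := by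
    refine LipschitzWith.add (LipschitzWith.subtype_val _) (LipschitzWith.of_dist_le_mul fun y z => ?_)
    rw [dist_eq_norm, ← sub_smul, norm_smul, he, mul_one]
    exact hγ.dist_le_mul y z
  set S := frontier Ω ∩ Metric.ball x₀ s
  have hSm : MeasurableSet S := isClosed_frontier.measurableSet.inter measurableSet_ball
  have hSΦ : S ⊆ Set.range Φ := by
    intro x hx
    refine ⟨P x, ?_⟩
    have h1 := (hgraph x hx.1 hx.2).1
    have h2 := Submodule.starProjection_add_starProjection_orthogonal (K := ℝ ∙ e) x
    rw [Submodule.starProjection_unit_singleton ℝ he, add_comm] at h2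
    simp only [Φ, h1]
    exact h2
  refine ⟨s, hs, e, he, ((1 + K : NNReal) : ℝ≥0∞) ^ (N - 1), by simp, fun h hh t hts => ?_⟩
  have hcont : Continuous fun q : RN N × ℝ => q.1 + q.2 • e := by fun_prop
  refine (hΦ.setLIntegral_euclideanHausdorffMeasure_le (N - 1) hSΦ
    ((hh.comp hcont.measurable).lintegral_prod_right' (ν := volume.restrict (Set.Ioc 0 t)))).trans ?_
  gcongr
  rw [← finrank_orthogonal_span_singleton_of_norm_eq_one he,
    InnerProductSpace.euclideanHausdorffMeasure_eq_volume]
  have hmp := measurePreserving_graph he hγ.continuous.measurable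
  have hSΦm : MeasurableSet (Φ ⁻¹' S) := hΦ.continuous.measurable hSm
  have hle := setLIntegral_comp_le_of_mapsTo hmp (A := (Φ ⁻¹' S) ×ˢ Set.Ioc 0 t)
    (hSΦm.prod measurableSet_Ioc) hΩ.isOpen.measurableSet hh
    fun p hp => (hgraph _ hp.1.1 hp.1.2).2 p.2 hp.2.1 (hp.2.2.trans_lt hts)
  refine le_trans (le_of_eq ?_) hle
  rw [← Measure.prod_restrict]
  exact (lintegral_prod _ (hh.comp hmp.measurable).aemeasurable).symm

/-- Average the segment estimate in direction e over lengths τ ∈ (0, t] and integrate over the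
boundary piece: the collar bound gives coefficients 2 t c for the gradient and 2 c / t for φ². Small
t makes the first small. -/
theorem exists_local_trace_le (hΩ : IsLipschitzDomain Ω) {x₀ : RN N} (hx₀ : x₀ ∈ frontier Ω) :
    ∃ s : ℝ, 0 < s ∧ ∀ η : ℝ≥0∞, η ≠ 0 → ∃ C : ℝ≥0∞, C ≠ ⊤ ∧ ∀ φ : RN N → ℝ, ContDiff ℝ 1 φ →
      ∫⁻ x in frontier Ω ∩ Metric.ball x₀ s, ‖φ x‖ₑ ^ 2
        ∂(Measure.euclideanHausdorffMeasure (N - 1)) ≤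
        η * (∫⁻ x in Ω, ‖gradient φ x‖ₑ ^ 2) + C * ∫⁻ x in Ω, ‖φ x‖ₑ ^ 2 := by
  obtain ⟨s, hs, e, he, c, hc, hcollar⟩ := hΩ.exists_collar hx₀
  refine ⟨s, hs, fun η hη => ?_⟩
  obtain ⟨t, ht, hts, htη⟩ : ∃ t : ℝ, 0 < t ∧ t < s ∧ 2 * ENNReal.ofReal t * c ≤ η := by
    have hlim : Tendsto (fun t : ℝ => 2 * ENNReal.ofReal t * c) (𝓝[>] 0) (𝓝 0) := by
      have h0 : Tendsto (fun t : ℝ => ENNReal.ofReal t) (𝓝 0) (𝓝 0) := by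
        simpa using ENNReal.continuous_ofReal.tendsto 0
      have h1 := ENNReal.Tendsto.mul_const (b := c)
        (ENNReal.Tendsto.const_mul (a := 2) h0 (Or.inr (by simp))) (Or.inr hc)
      rw [mul_zero, zero_mul] at h1
      exact h1.mono_left nhdsWithin_le_nhds
    obtain ⟨t, h1, h2, h3⟩ := ((hlim.eventually_le_const (pos_iff_ne_zero.2 hη)).and
      (Ioo_mem_nhdsGT hs)).exists
    exact ⟨t, h2, h3, h1⟩
  set T := ENNReal.ofReal t
  have hT0 : T ≠ 0 := by simpa [T] using ht
  have hTtop : T ≠ ⊤ := ENNReal.ofReal_ne_top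
  refine ⟨2 * T⁻¹ * c, ENNReal.mul_ne_top (ENNReal.mul_ne_top (by simp) (by simpa using hT0)) hc,
    fun φ hφ => ?_⟩
  have hcφ : Continuous φ := hφ.continuous
  have hcg := hφ.continuous_gradient
  have hee : ‖e‖ₑ = 1 := by rw [← ofReal_norm, he, ENNReal.ofReal_one]
  set σ : Measure (RN N) :=
    (Measure.euclideanHausdorffMeasure (N - 1)).restrict (frontier Ω ∩ Metric.ball x₀ s)
  have hcont : Continuous fun q : RN N × ℝ => q.1 + q.2 • e := by fun_prop
  have hpt : ∀ x, T * ‖φ x‖ₑ ^ 2 ≤ 2 * (∫⁻ τ in Set.Ioc 0 t, ‖φ (x + τ • e)‖ₑ ^ 2) +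
      2 * T * T * ∫⁻ τ in Set.Ioc 0 t, ‖gradient φ (x + τ • e)‖ₑ ^ 2 := by
    intro x
    calc T * ‖φ x‖ₑ ^ 2 = ∫⁻ _ in Set.Ioc 0 t, ‖φ x‖ₑ ^ 2 := by
          rw [setLIntegral_const, mul_comm, Real.volume_Ioc, sub_zero]
      _ ≤ ∫⁻ τ in Set.Ioc 0 t, (2 * ‖φ (x + τ • e)‖ₑ ^ 2 +
          2 * T * ∫⁻ τ in Set.Ioc 0 t, ‖gradient φ (x + τ • e)‖ₑ ^ 2) := by
        refine setLIntegral_mono' measurableSet_Ioc fun τ hτ => ?_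
        have h := hφ.enorm_sq_le_along_segment x e hτ.1.le
        rw [hee, one_pow, mul_one] at h
        refine h.trans ?_
        rw [mul_assoc 2 T]
        gcongr
        · exact ENNReal.ofReal_le_ofReal hτ.2
        · exact hτ.2
      _ = _ := by
        rw [lintegral_add_right _ measurable_const, lintegral_const_mul' _ _ (by simp),
          setLIntegral_const, Real.volume_Ioc, sub_zero]
        ring
  have hmain : T * ∫⁻ x, ‖φ x‖ₑ ^ 2 ∂σ ≤ 2 * (c * ∫⁻ x in Ω, ‖φ x‖ₑ ^ 2) +
      2 * T * T * (c * ∫⁻ x in Ω, ‖gradient φ x‖ₑ ^ 2) := by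
    have hTT : 2 * T * T ≠ ⊤ := ENNReal.mul_ne_top (ENNReal.mul_ne_top (by simp) hTtop) hTtop
    rw [← lintegral_const_mul' _ _ hTtop]
    refine (lintegral_mono hpt).trans ?_
    rw [lintegral_add_left, lintegral_const_mul' _ _ (by simp), lintegral_const_mul' _ _ hTT]
    · gcongr
      · exact hcollar _ (hcφ.enorm.measurable.pow_const 2) t hts
      · exact hcollar _ (hcg.enorm.measurable.pow_const 2) t hts
    · refine Measurable.const_mul ?_ 2
      exact (((hcφ.comp hcont).enorm.measurable.pow_const 2).lintegral_prod_right'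
        (ν := volume.restrict (Set.Ioc 0 t)))
  calc ∫⁻ x, ‖φ x‖ₑ ^ 2 ∂σ = T⁻¹ * (T * ∫⁻ x, ‖φ x‖ₑ ^ 2 ∂σ) := by
        rw [← mul_assoc, ENNReal.inv_mul_cancel hT0 hTtop, one_mul]
    _ ≤ T⁻¹ * (2 * (c * ∫⁻ x in Ω, ‖φ x‖ₑ ^ 2) +
        2 * T * T * (c * ∫⁻ x in Ω, ‖gradient φ x‖ₑ ^ 2)) := by gcongr
    _ = (T⁻¹ * T) * (2 * T * c) * (∫⁻ x in Ω, ‖gradient φ x‖ₑ ^ 2) +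
        2 * T⁻¹ * c * ∫⁻ x in Ω, ‖φ x‖ₑ ^ 2 := by ring
    _ ≤ _ := by
        rw [ENNReal.inv_mul_cancel hT0 hTtop, one_mul]
        gcongr

theorem exists_trace_le (hΩ : IsLipschitzDomain Ω) (hbdd : Bornology.IsBounded Ω)
    {η : ℝ≥0∞} (hη : η ≠ 0) :
    ∃ C : ℝ≥0∞, C ≠ ⊤ ∧ ∀ φ : RN N → ℝ, ContDiff ℝ 1 φ →
      ∫⁻ x, ‖φ x‖ₑ ^ 2 ∂(surfaceMeasure Ω) ≤
        η * (∫⁻ x in Ω, ‖gradient φ x‖ₑ ^ 2) + C * ∫⁻ x in Ω, ‖φ x‖ₑ ^ 2 := by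
  have hcompact : IsCompact (frontier Ω) :=
    hbdd.isCompact_closure.of_isClosed_subset isClosed_frontier frontier_subset_closure
  have key := hcompact.induction_on (p := fun S => ∀ η : ℝ≥0∞, η ≠ 0 →
    ∃ C : ℝ≥0∞, C ≠ ⊤ ∧ ∀ φ : RN N → ℝ, ContDiff ℝ 1 φ →
      ∫⁻ x in frontier Ω ∩ S, ‖φ x‖ₑ ^ 2 ∂(Measure.euclideanHausdorffMeasure (N - 1)) ≤
        η * (∫⁻ x in Ω, ‖gradient φ x‖ₑ ^ 2) + C * ∫⁻ x in Ω, ‖φ x‖ₑ ^ 2)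
    (fun η _ => ⟨0, by simp, fun φ _ => by simp⟩) ?_ ?_ ?_ η hη
  · simpa only [Set.inter_self] using! key
  · intro s t hst ht η hη
    obtain ⟨C, hC, h⟩ := ht η hη
    refine ⟨C, hC, fun φ hφ => (lintegral_mono_set ?_).trans (h φ hφ)⟩
    gcongr
  · intro s t hs ht η hη
    obtain ⟨C, hC, h⟩ := hs (η / 2) (by simpa using hη)
    obtain ⟨C', hC', h'⟩ := ht (η / 2) (by simpa using hη)
    refine ⟨C + C', by simp [hC, hC'], fun φ hφ => ?_⟩
    rw [Set.inter_union_distrib_left]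
    refine (lintegral_union_le _ _ _).trans ((add_le_add (h φ hφ) (h' φ hφ)).trans_eq ?_)
    conv_rhs => rw [← ENNReal.add_halves η]
    ring
  · intro x hx
    obtain ⟨r, hr, h⟩ := hΩ.exists_local_trace_le hx
    exact ⟨Metric.ball x r, mem_nhdsWithin_of_mem_nhds (Metric.ball_mem_nhds x hr), h⟩

end IsLipschitzDomain

/-! ### Mollification in L² -/

section

variable {V E : Type*} [NormedAddCommGroup V] [InnerProductSpace ℝ V] [FiniteDimensional ℝ V]
  [MeasurableSpace V] [BorelSpace V] [NormedAddCommGroup E]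

/-- Translations act continuously on `L²`. -/
theorem MeasureTheory.MemLp.tendsto_eLpNorm_comp_sub {F : V → E} (hF : MemLp F 2 volume) :
    Tendsto (fun z : V => eLpNorm (fun x => F (x - z) - F x) 2 volume) (𝓝 0) (𝓝 0) := by
  -- Translations form a continuous family of measure-preserving maps, so continuity of composition
  -- in L² applies.
  let g : C(V, C(V, V)) := ContinuousMap.curry ⟨fun p : V × V => p.2 - p.1, by fun_prop⟩
  have hg : ∀ z, MeasurePreserving (g z) (volume : Measure V) volume := fun z =>
    measurePreserving_sub_right volume z
  have hcont : Continuous fun z : V => Lp.compMeasurePreserving (g z) (hg z) (hF.toLp F) :=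
    continuous_const.compMeasurePreservingLp g.continuous hg (by simp)
  have h0 := (Lp.tendsto_Lp_iff_tendsto_eLpNorm' _ _).1 (hcont.tendsto 0)
  refine h0.congr fun z => eLpNorm_congr_ae ?_
  have e1 : ∀ z, Lp.compMeasurePreserving (g z) (hg z) (hF.toLp F) =ᵐ[volume] fun x => F (x - z) := by
    intro z
    refine (Lp.coeFn_compMeasurePreserving _ (hg z)).trans ?_
    exact (hg z).quasiMeasurePreserving.ae_eq_comp hF.coeFn_toLp
  filter_upwards [e1 z, e1 0] with x h1 h2
  rw [Pi.sub_apply, h1, h2, sub_zero]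

/-- The difference ρ * F - F is the mean of the translation differences of F under the probability
measure ρ dz. Cauchy-Schwarz and Tonelli bound its L² norm by the largest translation error over the
support of ρ. -/
theorem eLpNorm_convolution_sub_le [NormedSpace ℝ E] [CompleteSpace E] {F : V → E} (hF : MemLp F 2 volume) {ρ : V → ℝ}
    (hρ : Continuous ρ) (hρc : HasCompactSupport ρ) (hρ0 : ∀ z, 0 ≤ ρ z) (hρ1 : ∫ z, ρ z = 1)
    {ε : ℝ≥0∞} (hε : ∀ z ∈ Function.support ρ, eLpNorm (fun x => F (x - z) - F x) 2 volume ≤ ε) :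
    eLpNorm (fun x => convolution ρ F (ContinuousLinearMap.lsmul ℝ ℝ) volume x - F x) 2 volume
      ≤ ε := by
  set ν : Measure V := volume.withDensity fun z => ‖ρ z‖ₑ with hν
  have hρm : Measurable fun z => ‖ρ z‖ₑ := hρ.enorm.measurable
  have hρint : Integrable ρ := hρ.integrable_of_hasCompactSupport hρc
  have hν1 : ν Set.univ = 1 := by
    rw [hν, withDensity_apply _ MeasurableSet.univ, Measure.restrict_univ]
    have := ofReal_integral_norm_eq_lintegral_enorm hρint
    simp only [Real.norm_of_nonneg (hρ0 _), hρ1, ENNReal.ofReal_one] at this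
    exact this.symm
  have : IsProbabilityMeasure ν := ⟨hν1⟩
  have hac : ν ≪ volume := withDensity_absolutelyContinuous _ _
  have hνsupp : ∀ᵐ z ∂ν, z ∈ Function.support ρ := by
    rw [hν, ae_withDensity_iff hρm]
    exact Eventually.of_forall fun z hz => by simpa using hz
  have hLI : LocallyIntegrable F volume := hF.locallyIntegrable (by norm_num)
  have hconv := hρc.convolutionExists_left (ContinuousLinearMap.lsmul ℝ ℝ) hρ hLI
  have hshift : ∀ x, Measure.QuasiMeasurePreserving (fun z => x - z) ν volume := fun x =>
    (Measure.measurePreserving_sub_left volume x).quasiMeasurePreserving.mono_left hac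
  have hpt : ∀ x, ‖convolution ρ F (ContinuousLinearMap.lsmul ℝ ℝ) volume x - F x‖ₑ ^ 2 ≤
      ∫⁻ z, ‖F (x - z) - F x‖ₑ ^ 2 ∂ν := by
    intro x
    have hint : Integrable (fun z => ρ z • F (x - z)) := hconv x
    have heq : convolution ρ F (ContinuousLinearMap.lsmul ℝ ℝ) volume x - F x =
        ∫ z, ρ z • (F (x - z) - F x) := by
      simp only [smul_sub]
      rw [integral_sub hint (hρint.smul_const _), integral_smul_const, hρ1, one_smul]
      rfl
    have h1 : ‖convolution ρ F (ContinuousLinearMap.lsmul ℝ ℝ) volume x - F x‖ₑ ≤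
        ∫⁻ z, ‖F (x - z) - F x‖ₑ ∂ν := by
      rw [heq, hν, lintegral_withDensity_eq_lintegral_mul_non_measurable _ hρm (by simp)]
      refine (enorm_integral_le_lintegral_enorm _).trans_eq ?_
      simp only [enorm_smul, Pi.mul_apply]
    have hmeas : AEMeasurable (fun z => ‖F (x - z) - F x‖ₑ) ν :=
      ((hF.1.comp_quasiMeasurePreserving (hshift x)).sub aestronglyMeasurable_const).enorm
    calc _ ≤ (∫⁻ z, ‖F (x - z) - F x‖ₑ ∂ν) ^ 2 := by gcongr
      _ ≤ ν Set.univ * ∫⁻ z, ‖F (x - z) - F x‖ₑ ^ 2 ∂ν := sq_lintegral_le ν hmeas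
      _ = _ := by rw [hν1, one_mul]
  have hsq : eLpNorm (fun x => convolution ρ F (ContinuousLinearMap.lsmul ℝ ℝ) volume x - F x) 2
      volume ^ 2 ≤ ε ^ 2 := by
    rw [eLpNorm_two_sq]
    refine (lintegral_mono hpt).trans ?_
    rw [lintegral_lintegral_swap]
    · calc ∫⁻ z, (∫⁻ x, ‖F (x - z) - F x‖ₑ ^ 2) ∂ν ≤ ∫⁻ _, ε ^ 2 ∂ν := by
            refine lintegral_mono_ae ?_
            filter_upwards [hνsupp] with z hz
            rw [← eLpNorm_two_sq]
            gcongr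
            exact hε z hz
        _ = ε ^ 2 := by simp
    · have h1 : AEStronglyMeasurable (fun p : V × V => F (p.1 - p.2)) (volume.prod ν) :=
        hF.1.comp_quasiMeasurePreserving (quasiMeasurePreserving_sub_of_right_invariant volume ν)
      exact (h1.sub hF.1.comp_fst).enorm.pow_const 2
  exact (ENNReal.pow_le_pow_left_iff two_ne_zero).1 hsq

end

/-! ### Weak gradients under convolution -/

section

variable {V E : Type*} [NormedAddCommGroup V] [MeasurableSpace V] [BorelSpace V]
  [NormedAddCommGroup E] [NormedSpace ℝ E]

theorem MeasureTheory.Integrable.continuous_smul {μ : Measure V} {f : V → E} (hf : Integrable f μ)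
    {g : V → ℝ} (hg : Continuous g) (hgc : HasCompactSupport g) :
    Integrable (fun x => g x • f x) μ := by
  obtain ⟨C, hC⟩ := hgc.exists_bound_of_continuous hg
  exact hf.bdd_smul C hg.measurable.aestronglyMeasurable (Eventually.of_forall hC)

theorem MeasureTheory.Integrable.smul_continuous [FiniteDimensional ℝ E] {μ : Measure V}
    {f : V → ℝ} (hf : Integrable f μ) {g : V → E} (hg : Continuous g) (hgc : HasCompactSupport g) :
    Integrable (fun x => f x • g x) μ := by
  obtain ⟨C, hC⟩ := hgc.exists_bound_of_continuous hg
  have : ProperSpace E := FiniteDimensional.proper_real E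
  borelize E
  refine (hf.norm.mul_const C).mono' (hf.1.smul hg.measurable.aestronglyMeasurable) ?_
  refine Eventually.of_forall fun x => ?_
  rw [norm_smul]
  exact mul_le_mul_of_nonneg_left (hC x) (norm_nonneg _)

end

section

variable {V : Type*} [NormedAddCommGroup V] [InnerProductSpace ℝ V] [CompleteSpace V]

theorem gradient_hasCompactSupport {χ : V → ℝ} (hχ : HasCompactSupport χ) :
    HasCompactSupport (gradient χ) :=
  (hχ.fderiv ℝ).comp_left (g := (InnerProductSpace.toDual ℝ V).symm) (map_zero _)

theorem hasGradientAt_comp_sub_mul {ρ χ : V → ℝ} (hρ : Differentiable ℝ ρ)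
    (hχ : Differentiable ℝ χ) (x y : V) :
    HasGradientAt (fun y => ρ (x - y) * χ y) (ρ (x - y) • gradient χ y - χ y • gradient ρ (x - y))
      y := by
  have h1 : HasFDerivAt ρ (InnerProductSpace.toDual ℝ V (gradient ρ (x - y))) (x - y) :=
    (hρ _).hasGradientAt.hasFDerivAt
  have h2 : HasFDerivAt χ (InnerProductSpace.toDual ℝ V (gradient χ y)) y :=
    (hχ _).hasGradientAt.hasFDerivAt
  have h3 : HasFDerivAt (fun y => ρ (x - y)) _ y := h1.comp y ((hasFDerivAt_id y).const_sub x)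
  rw [hasGradientAt_iff_hasFDerivAt]
  convert! h3.mul h2 using 1
  ext v
  simp
  ring

end

section

variable {N : ℕ} {Ω : Set (RN N)} {u : RN N → ℝ} {G : RN N → RN N} {χ ρ : RN N → ℝ} {x : RN N}

/-- The test function is y ↦ ρ(x - y) χ(y); the reflected argument gives the minus sign in its
gradient. -/
theorem HasWeakGradient.setIntegral_eq (hw : HasWeakGradient Ω u G) (hu : IntegrableOn u Ω)
    (hG : IntegrableOn G Ω) (hχ : ContDiff ℝ ∞ χ) (hχc : HasCompactSupport χ)
    (hρ : ContDiff ℝ ∞ ρ) (hsupp : tsupport (fun y => ρ (x - y) * χ y) ⊆ Ω) :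
    ∫ y in Ω, ρ (x - y) • (χ y • G y + u y • gradient χ y) =
      ∫ y in Ω, u y • (χ y • gradient ρ (x - y)) := by
  have hρ1 : ContDiff ℝ 1 ρ := hρ.of_le (by simp)
  have hχ1 : ContDiff ℝ 1 χ := hχ.of_le (by simp)
  have hψsm : ContDiff ℝ ∞ (fun y => ρ (x - y) * χ y) :=
    (hρ.comp (contDiff_const.sub contDiff_id)).mul hχ
  have hψc : HasCompactSupport (fun y => ρ (x - y) * χ y) := hχc.mul_left
  have hψgrad : ∀ y, gradient (fun y => ρ (x - y) * χ y) y =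
      ρ (x - y) • gradient χ y - χ y • gradient ρ (x - y) := fun y =>
    (hasGradientAt_comp_sub_mul (hρ1.differentiable one_ne_zero) (hχ1.differentiable one_ne_zero)
      x y).gradient
  have hcρ : Continuous fun y => ρ (x - y) := hρ.continuous.comp (by fun_prop)
  have hcρg : Continuous fun y => gradient ρ (x - y) := hρ1.continuous_gradient.comp (by fun_prop)
  have i1 : IntegrableOn (fun y => (ρ (x - y) * χ y) • G y) Ω :=
    hG.continuous_smul hψsm.continuous hψc
  have hρχc : HasCompactSupport (fun y => ρ (x - y) • gradient χ y) :=
    HasCompactSupport.smul_left (f := fun y => ρ (x - y)) (gradient_hasCompactSupport hχc)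
  have i2 : IntegrableOn (fun y => u y • (ρ (x - y) • gradient χ y)) Ω :=
    hu.smul_continuous (hcρ.smul hχ1.continuous_gradient) hρχc
  have i3 : IntegrableOn (fun y => u y • (χ y • gradient ρ (x - y))) Ω :=
    hu.smul_continuous (hχ.continuous.smul hcρg) hχc.smul_right
  calc ∫ y in Ω, ρ (x - y) • (χ y • G y + u y • gradient χ y)
      = ∫ y in Ω, ((ρ (x - y) * χ y) • G y + u y • (ρ (x - y) • gradient χ y)) := by
        congr 1 with y : 1
        rw [smul_add, smul_smul, smul_comm]
    _ = - (∫ y in Ω, u y • gradient (fun y => ρ (x - y) * χ y) y) +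
        ∫ y in Ω, u y • (ρ (x - y) • gradient χ y) := by
        rw [integral_add i1 i2, hw.integral_eq _ hψsm hψc hsupp, neg_neg]
    _ = ∫ y in Ω, u y • (χ y • gradient ρ (x - y)) := by
        simp only [hψgrad, smul_sub]
        rw [integral_sub i2 i3]
        abel

theorem hasGradientAt_convolution {F : RN N → ℝ} (hF : LocallyIntegrable F) (hρ : ContDiff ℝ 1 ρ)
    (hρc : HasCompactSupport ρ) (x : RN N) :
    HasGradientAt (convolution ρ F (ContinuousLinearMap.lsmul ℝ ℝ) volume)
      (∫ y, F y • gradient ρ (x - y)) x := by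
  have h1 := hρc.hasFDerivAt_convolution_left (ContinuousLinearMap.lsmul ℝ ℝ) hρ hF x
  have h2 : convolution (fderiv ℝ ρ) F ((ContinuousLinearMap.lsmul ℝ ℝ).precompL (RN N)) volume x =
      ∫ y, F y • fderiv ℝ ρ (x - y) := by
    rw [convolution_eq_swap]
    congr 1 with y : 1
    ext v
    simp [mul_comm]
  rw [h2] at h1
  have h3 := h1.hasGradientAt
  have h4 := ((InnerProductSpace.toDual ℝ (RN N)).symm.toContinuousLinearEquiv :
    StrongDual ℝ (RN N) ≃L[ℝ] RN N).integral_comp_comm (μ := volume)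
      (fun y => F y • fderiv ℝ ρ (x - y))
  convert! h3 using 1
  refine Eq.trans ?_ h4
  congr 1 with y : 1
  simp [gradient]

/-- Extension by zero may create a jump across ∂Ω, but the support condition keeps ρ(x - ·)χ away
from it. At such x, differentiation commutes with convolution as if there were no boundary. -/
theorem HasWeakGradient.hasGradientAt_convolution (hΩ : IsOpen Ω)
    (hw : HasWeakGradient Ω u G) (hu : IntegrableOn u Ω)
    (hG : IntegrableOn G Ω) (hχ : ContDiff ℝ ∞ χ) (hχc : HasCompactSupport χ)
    (hρ : ContDiff ℝ ∞ ρ) (hρc : HasCompactSupport ρ)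
    (hsupp : tsupport (fun y => ρ (x - y) * χ y) ⊆ Ω) :
    HasGradientAt (convolution ρ (Ω.indicator fun y => χ y * u y) (ContinuousLinearMap.lsmul ℝ ℝ)
      volume) (convolution ρ (Ω.indicator fun y => χ y • G y + u y • gradient χ y)
        (ContinuousLinearMap.lsmul ℝ ℝ) volume x) x := by
  have hΩm := hΩ.measurableSet
  have hFint : Integrable (Ω.indicator fun y => χ y * u y) :=
    (integrable_indicator_iff hΩm).2 (hu.continuous_smul hχ.continuous hχc)
  convert! _root_.hasGradientAt_convolution hFint.locallyIntegrable
    (hρ.of_le (by simp)) hρc x using 1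
  calc _ = ∫ y, Ω.indicator (fun y => ρ (x - y) • (χ y • G y + u y • gradient χ y)) y := by
        rw [convolution_eq_swap]
        congr 1 with y : 1
        by_cases hy : y ∈ Ω <;> simp [hy]
    _ = ∫ y, Ω.indicator (fun y => u y • (χ y • gradient ρ (x - y))) y := by
        rw [integral_indicator hΩm, integral_indicator hΩm, hw.setIntegral_eq hu hG hχ hχc hρ hsupp]
    _ = _ := by
        congr 1 with y : 1
        by_cases hy : y ∈ Ω
        · simp [hy, smul_smul, mul_comm]
        · simp [hy]

end

/-! ### Uniqueness of weak gradients and density of smooth functions -/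

section

variable {N : ℕ} {Ω : Set (RN N)}

/-- Needed because `IsTrace` and `MemH1` each supply a weak gradient of their own. -/
theorem HasWeakGradient.ae_eq (hΩ : IsOpen Ω) {u : RN N → ℝ} {G₁ G₂ : RN N → RN N}
    (h₁ : HasWeakGradient Ω u G₁) (h₂ : HasWeakGradient Ω u G₂) :
    G₁ =ᵐ[volume.restrict Ω] G₂ := by
  have hint : ∀ G : RN N → RN N, LocallyIntegrableOn G Ω (volume : Measure (RN N)) → ∀ φ : RN N → ℝ,
      ContDiff ℝ ∞ φ → HasCompactSupport φ → tsupport φ ⊆ Ω →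
      Integrable (fun x => φ x • G x) (volume.restrict Ω) := by
    intro G hG φ hφ hφc hφs
    have h := ((hG.integrableOn_compact_subset hφs hφc).continuous_smul hφ.continuous hφc)
    exact ((integrableOn_iff_integrable_of_support_subset
      ((Function.support_smul_subset_left φ G).trans (subset_tsupport φ))).1 h).integrableOn
  have h := hΩ.ae_eq_zero_of_integral_contDiff_smul_eq_zero (f := fun x => G₁ x - G₂ x)
    (μ := volume) (h₁.locallyIntegrable_grad.sub h₂.locallyIntegrable_grad) ?_
  · rw [EventuallyEq, ae_restrict_iff' hΩ.measurableSet]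
    filter_upwards [h] with x hx hxΩ using sub_eq_zero.1 (hx hxΩ)
  · intro φ hφ hφc hφs
    have h3 : ∫ x in Ω, φ x • (G₁ x - G₂ x) = 0 := by
      simp only [smul_sub]
      rw [integral_sub (hint G₁ h₁.locallyIntegrable_grad φ hφ hφc hφs)
        (hint G₂ h₂.locallyIntegrable_grad φ hφ hφc hφs), sub_eq_zero, ← neg_inj,
        ← h₁.integral_eq φ hφ hφc hφs, ← h₂.integral_eq φ hφ hφc hφs]
    rw [← h3, setIntegral_eq_integral_of_forall_compl_eq_zero]
    intro x hx
    have : φ x = 0 := by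
      by_contra hne
      exact hx (hφs (subset_tsupport φ hne))
    rw [this, zero_smul]

namespace IsLipschitzDomain

/-- The mollifier is centred at -t e instead of 0, so for x ∈ Ω near x₀ the convolution only samples
x + t v with v in the cone, that is, points of Ω. Its shift is small, so it still converges in L².
-/
theorem exists_local_smooth_approx (hΩ : IsLipschitzDomain Ω) (hbdd : Bornology.IsBounded Ω)
    {x₀ : RN N} (hx₀ : x₀ ∈ closure Ω) :
    ∃ r : ℝ, 0 < r ∧ ∀ (u : RN N → ℝ) (G : RN N → RN N), HasWeakGradient Ω u G →
      MemLp u 2 (volume.restrict Ω) → MemLp G 2 (volume.restrict Ω) →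
      ∀ χ : RN N → ℝ, ContDiff ℝ ∞ χ → HasCompactSupport χ → tsupport χ ⊆ Metric.ball x₀ r →
      ∀ ε : ℝ≥0∞, ε ≠ 0 → ∃ φ : RN N → ℝ, ContDiff ℝ ∞ φ ∧
        eLpNorm (fun x => φ x - χ x * u x) 2 (volume.restrict Ω) ≤ ε ∧
        eLpNorm (fun x => gradient φ x - (χ x • G x + u x • gradient χ x)) 2
          (volume.restrict Ω) ≤ ε := by
  obtain ⟨r, hr, e, κ, hκ, hcone⟩ := hΩ.exists_cone hx₀
  refine ⟨r / 2, by positivity, fun u G hw hu hG χ hχ hχc hχs ε hε => ?_⟩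
  have hΩm := hΩ.isOpen.measurableSet
  have : IsFiniteMeasure (volume.restrict Ω) := ⟨by simpa using hbdd.measure_lt_top⟩
  have hui : IntegrableOn u Ω := memLp_one_iff_integrable.1 (hu.mono_exponent (by norm_num))
  have hGi : IntegrableOn G Ω := memLp_one_iff_integrable.1 (hG.mono_exponent (by norm_num))
  have hχ1 : ContDiff ℝ 1 χ := hχ.of_le (by simp)
  set F := Ω.indicator fun y => χ y * u y with hFdef
  set H := Ω.indicator fun y => χ y • G y + u y • gradient χ y with hHdef
  obtain ⟨c₁, hc₁⟩ := hχc.exists_bound_of_continuous hχ.continuous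
  obtain ⟨c₂, hc₂⟩ := (gradient_hasCompactSupport hχc).exists_bound_of_continuous
    hχ1.continuous_gradient
  have hχm := hχ.continuous.aestronglyMeasurable (μ := volume.restrict Ω)
  have hF : MemLp F 2 volume := by
    rw [hFdef, memLp_indicator_iff_restrict hΩm]
    refine hu.of_le_mul (hχm.mul hu.1) (c := c₁) (Eventually.of_forall fun x => ?_)
    rw [norm_mul]
    exact mul_le_mul_of_nonneg_right (hc₁ x) (norm_nonneg _)
  have hH : MemLp H 2 volume := by
    rw [hHdef, memLp_indicator_iff_restrict hΩm]
    refine MemLp.add ?_ ?_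
    · refine hG.of_le_mul (hχm.smul hG.1) (c := c₁) (Eventually.of_forall fun x => ?_)
      rw [norm_smul]
      exact mul_le_mul_of_nonneg_right (hc₁ x) (norm_nonneg _)
    · refine hu.of_le_mul (hu.1.smul hχ1.continuous_gradient.aestronglyMeasurable) (c := c₂)
        (Eventually.of_forall fun x => ?_)
      rw [norm_smul, mul_comm]
      exact mul_le_mul_of_nonneg_right (hc₂ x) (norm_nonneg _)
  obtain ⟨δ, hδ, hδε⟩ := Metric.eventually_nhds_iff_ball.1
    ((hF.tendsto_eLpNorm_comp_sub.eventually_le_const (pos_iff_ne_zero.2 hε)).and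
      (hH.tendsto_eLpNorm_comp_sub.eventually_le_const (pos_iff_ne_zero.2 hε)))
  set M : ℝ := ‖e‖ + κ with hM
  have hM0 : 0 < M := by positivity
  -- The conditions serve, in order, the cone property, the smallness of translations by δ, and
  -- keeping x within r of x₀ when x - z lies in the support of χ.
  obtain ⟨t, ht, htr, htδ, htr2⟩ : ∃ t : ℝ, 0 < t ∧ t < r ∧ t * M < δ ∧ t * M < r / 2 := by
    have hd : 0 < min δ (r / 2) := by positivity
    refine ⟨min (r / 2) (min δ (r / 2) / (2 * M)), by positivity, ?_, ?_⟩
    · exact (min_le_left _ _).trans_lt (by linarith)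
    · have h : min (r / 2) (min δ (r / 2) / (2 * M)) * M < min δ (r / 2) := by
        calc _ ≤ min δ (r / 2) / (2 * M) * M := by gcongr; exact min_le_right _ _
          _ = min δ (r / 2) / 2 := by field_simp
          _ < _ := by linarith
      exact ⟨h.trans_le (min_le_left _ _), h.trans_le (min_le_right _ _)⟩
  have htκ : 0 < t * κ := by positivity
  let b : ContDiffBump (-(t • e)) := ⟨t * κ / 4, t * κ / 2, by positivity, by linarith⟩
  set ρ := b.normed volume with hρdef
  have hρ : ContDiff ℝ ∞ ρ := b.contDiff_normed
  have hρc : HasCompactSupport ρ := b.hasCompactSupport_normed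
  have hcone' : ∀ z ∈ tsupport ρ, ‖z‖ ≤ t * M ∧ ∃ v ∈ Metric.ball e κ, -z = t • v := by
    intro z hz
    rw [hρdef, b.tsupport_normed_eq, Metric.mem_closedBall, dist_eq_norm, sub_neg_eq_add] at hz
    have hz' : ‖z + t • e‖ ≤ t * κ / 2 := hz
    constructor
    · calc ‖z‖ = ‖(z + t • e) - t • e‖ := by simp
        _ ≤ ‖z + t • e‖ + ‖t • e‖ := norm_sub_le _ _
        _ ≤ t * κ / 2 + t * ‖e‖ := by rw [norm_smul, Real.norm_of_nonneg ht.le]; gcongr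
        _ ≤ t * M := by rw [hM]; linarith
    · refine ⟨-(t⁻¹ • z), ?_, by rw [smul_neg, smul_smul, mul_inv_cancel₀ ht.ne', one_smul]⟩
      have h : -(t⁻¹ • z) - e = -(t⁻¹ • (z + t • e)) := by
        rw [smul_add, smul_smul, inv_mul_cancel₀ ht.ne', one_smul]; abel
      rw [Metric.mem_ball, dist_eq_norm, h, norm_neg, norm_smul, norm_inv,
        Real.norm_of_nonneg ht.le, inv_mul_lt_iff₀ ht]
      linarith
  have hsmall : ∀ z ∈ Function.support ρ, z ∈ Metric.ball (0 : RN N) δ := fun z hz => by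
    simpa using (hcone' z (subset_tsupport _ hz)).1.trans_lt htδ
  have hsupp : ∀ x ∈ Ω, tsupport (fun y => ρ (x - y) * χ y) ⊆ Ω := by
    intro x hx y hy
    have hy1 : y ∈ tsupport χ := (tsupport_mul_subset_right (f := fun y => ρ (x - y))) hy
    have hy2 : x - y ∈ tsupport ρ := by
      have h1 := (tsupport_mul_subset_left (f := fun y => ρ (x - y)) (g := χ)) hy
      exact tsupport_comp_subset_preimage ρ (f := fun y => x - y) (by fun_prop) h1
    obtain ⟨h1, v, hv, h2⟩ := hcone' _ hy2
    have hyx : y = x + t • v := by rw [← h2]; abel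
    have hd : dist x x₀ < r := by
      have := Metric.mem_ball.1 (hχs hy1)
      calc dist x x₀ ≤ dist x y + dist y x₀ := dist_triangle _ _ _
        _ < r := by rw [dist_eq_norm x y]; linarith
    rw [hyx]
    exact hcone x hx hd t ht htr v hv
  set φ := convolution ρ F (ContinuousLinearMap.lsmul ℝ ℝ) volume with hφdef
  refine ⟨φ, ?_, ?_, ?_⟩
  · exact hρc.contDiff_convolution_left (n := ⊤) _ hρ (hF.locallyIntegrable (by norm_num))
  · calc _ = eLpNorm (fun x => φ x - F x) 2 (volume.restrict Ω) := by
          refine eLpNorm_congr_ae ?_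
          filter_upwards [ae_restrict_mem hΩm] with x hx
          rw [hFdef, Set.indicator_of_mem hx]
      _ ≤ eLpNorm (fun x => φ x - F x) 2 volume := eLpNorm_restrict_le _ _ _ _
      _ ≤ ε := eLpNorm_convolution_sub_le hF hρ.continuous hρc b.nonneg_normed b.integral_normed
          fun z hz => (hδε z (hsmall z hz)).1
  · calc _ = eLpNorm (fun x => convolution ρ H (ContinuousLinearMap.lsmul ℝ ℝ) volume x - H x) 2
          (volume.restrict Ω) := by
          refine eLpNorm_congr_ae ?_
          filter_upwards [ae_restrict_mem hΩm] with x hx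
          rw [hHdef, Set.indicator_of_mem hx, (hw.hasGradientAt_convolution hΩ.isOpen hui hGi hχ hχc
            hρ hρc (hsupp x hx)).gradient]
      _ ≤ eLpNorm (fun x => convolution ρ H (ContinuousLinearMap.lsmul ℝ ℝ) volume x - H x) 2
          volume := eLpNorm_restrict_le _ _ _ _
      _ ≤ ε := eLpNorm_convolution_sub_le hH hρ.continuous hρc b.nonneg_normed b.integral_normed
          fun z hz => (hδε z (hsmall z hz)).2

end IsLipschitzDomain

end

open scoped Manifold in
/-- A compact set covered by open balls has a finite smooth partition of unity subordinate to the
cover. -/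
theorem IsCompact.exists_finite_smooth_partition {V : Type*} [NormedAddCommGroup V]
    [NormedSpace ℝ V] [FiniteDimensional ℝ V] {s : Set V} (hs : IsCompact s) {r : V → ℝ}
    (hr : ∀ x ∈ s, 0 < r x) :
    ∃ (t : Finset s) (χ : t → V → ℝ), (∀ i, ContDiff ℝ ∞ (χ i)) ∧ (∀ i, HasCompactSupport (χ i)) ∧
      (∀ i, tsupport (χ i) ⊆ Metric.ball (i.1 : V) (r i.1)) ∧ ∀ x ∈ s, ∑ i, χ i x = 1 := by
  have : ProperSpace V := FiniteDimensional.proper_real V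
  obtain ⟨t, ht⟩ := hs.elim_nhds_subcover' (fun x _ => Metric.ball x (r x))
    fun x hx => Metric.ball_mem_nhds x (hr x hx)
  obtain ⟨f, hf⟩ := SmoothPartitionOfUnity.exists_isSubordinate 𝓘(ℝ, V) hs.isClosed
    (fun i : t => Metric.ball (i.1 : V) (r i.1)) (fun _ => Metric.isOpen_ball) (fun x hx => by
      obtain ⟨i, hi, hxi⟩ := Set.mem_iUnion₂.1 (ht hx)
      exact Set.mem_iUnion.2 ⟨⟨i, hi⟩, hxi⟩)
  refine ⟨t, fun i => f i, fun i => (f i).contMDiff.contDiff, fun i => ?_, hf, fun x hx => ?_⟩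
  · exact Metric.isCompact_of_isClosed_isBounded (isClosed_tsupport _)
      (Metric.isBounded_ball.subset (hf i))
  · rw [← finsum_eq_sum_of_fintype]
    exact f.sum_eq_one hx

section

variable {V : Type*} [NormedAddCommGroup V] [InnerProductSpace ℝ V] [CompleteSpace V]

theorem gradient_fun_sum {ι : Type*} (s : Finset ι) {f : ι → V → ℝ} {x : V}
    (hf : ∀ i ∈ s, DifferentiableAt ℝ (f i) x) :
    gradient (fun y => ∑ i ∈ s, f i y) x = ∑ i ∈ s, gradient (f i) x := by
  simp only [gradient, fderiv_fun_sum hf, map_sum]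

end

namespace IsLipschitzDomain

variable {N : ℕ} {Ω : Set (RN N)}

theorem exists_smooth_approx (hΩ : IsLipschitzDomain Ω) (hbdd : Bornology.IsBounded Ω)
    {u : RN N → ℝ} {G : RN N → RN N} (hw : HasWeakGradient Ω u G)
    (hu : MemLp u 2 (volume.restrict Ω)) (hG : MemLp G 2 (volume.restrict Ω))
    {ε : ℝ≥0∞} (hε : ε ≠ 0) :
    ∃ φ : RN N → ℝ, ContDiff ℝ ∞ φ ∧
      eLpNorm (fun x => φ x - u x) 2 (volume.restrict Ω) ≤ ε ∧
      eLpNorm (fun x => gradient φ x - G x) 2 (volume.restrict Ω) ≤ ε := by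
  have hΩm := hΩ.isOpen.measurableSet
  have hloc : ∀ x : RN N, ∃ r : ℝ, x ∈ closure Ω → 0 < r ∧ ∀ χ : RN N → ℝ, ContDiff ℝ ∞ χ →
      HasCompactSupport χ → tsupport χ ⊆ Metric.ball x r → ∀ ε : ℝ≥0∞, ε ≠ 0 →
      ∃ φ : RN N → ℝ, ContDiff ℝ ∞ φ ∧
        eLpNorm (fun x => φ x - χ x * u x) 2 (volume.restrict Ω) ≤ ε ∧
        eLpNorm (fun x => gradient φ x - (χ x • G x + u x • gradient χ x)) 2
          (volume.restrict Ω) ≤ ε := by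
    intro x
    by_cases hx : x ∈ closure Ω
    · obtain ⟨r, hr, h⟩ := hΩ.exists_local_smooth_approx hbdd hx
      exact ⟨r, fun _ => ⟨hr, h u G hw hu hG⟩⟩
    -- A dummy radius: `choose` needs a value off the closure.
    · exact ⟨0, fun h => absurd h hx⟩
  choose r hr using hloc
  obtain ⟨t, χ, hχ, hχc, hχs, hχ1⟩ := hbdd.isCompact_closure.exists_finite_smooth_partition
    (r := r) fun x hx => (hr x hx).1
  -- If the partition is empty the quotient is ⊤, which is harmless since the sum is then empty.
  have hε' : ε / (Fintype.card t : ℝ≥0∞) ≠ 0 :=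
    (ENNReal.div_pos hε (ENNReal.natCast_ne_top _)).ne'
  choose φ hφ hφ1 hφ2 using fun i : t =>
    (hr i.1 i.1.2).2 (χ i) (hχ i) (hχc i) (hχs i) _ hε'
  have hd : ∀ f : RN N → ℝ, ContDiff ℝ ∞ f → Differentiable ℝ f := fun f hf =>
    hf.differentiable (by simp)
  have hcg : ∀ f : RN N → ℝ, ContDiff ℝ ∞ f → AEStronglyMeasurable (gradient f)
      (volume.restrict Ω) := fun f hf =>
    (ContDiff.continuous_gradient (hf.of_le (by simp))).aestronglyMeasurable
  have hcm : ∀ f : RN N → ℝ, ContDiff ℝ ∞ f → AEStronglyMeasurable f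
      (volume.restrict Ω) := fun f hf => hf.continuous.aestronglyMeasurable
  -- The partition sums to 1 on a neighbourhood of each point of Ω, so the extra terms u ∇χᵢ cancel.
  have hχgrad : ∀ x ∈ Ω, ∑ i, gradient (χ i) x = 0 := by
    intro x hx
    rw [← gradient_fun_sum _ fun i _ => (hd _ (hχ i)) x]
    have : (fun y => ∑ i, χ i y) =ᶠ[𝓝 x] fun _ => 1 := by
      filter_upwards [hΩ.isOpen.mem_nhds hx] with y hy using hχ1 y (subset_closure hy)
    rw [this.gradient_eq, gradient_fun_const]
  have hsum : ∀ a : t → ℝ≥0∞, (∀ i, a i ≤ ε / (Fintype.card t : ℝ≥0∞)) → ∑ i, a i ≤ ε := by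
    intro a ha
    calc ∑ i, a i ≤ ∑ _i : t, ε / (Fintype.card t : ℝ≥0∞) := Finset.sum_le_sum fun i _ => ha i
      _ = (Fintype.card t : ℝ≥0∞) * (ε / (Fintype.card t : ℝ≥0∞)) := by simp
      _ ≤ ε := ENNReal.mul_div_le
  refine ⟨fun x => ∑ i, φ i x, ContDiff.sum fun i _ => hφ i, ?_, ?_⟩
  · calc _ = eLpNorm (∑ i, fun x => φ i x - χ i x * u x) 2 (volume.restrict Ω) := by
          refine eLpNorm_congr_ae ?_
          filter_upwards [ae_restrict_mem hΩm] with x hx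
          rw [Finset.sum_apply, Finset.sum_sub_distrib, ← Finset.sum_mul,
            hχ1 x (subset_closure hx), one_mul]
      _ ≤ ∑ i, eLpNorm (fun x => φ i x - χ i x * u x) 2 (volume.restrict Ω) :=
          eLpNorm_sum_le (fun i _ => (hcm _ (hφ i)).sub ((hcm _ (hχ i)).mul hu.1)) (by norm_num)
      _ ≤ ε := hsum _ hφ1
  · calc _ = eLpNorm (∑ i, fun x => gradient (φ i) x - (χ i x • G x + u x • gradient (χ i) x)) 2
          (volume.restrict Ω) := by
          refine eLpNorm_congr_ae ?_
          filter_upwards [ae_restrict_mem hΩm] with x hx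
          rw [Finset.sum_apply, Finset.sum_sub_distrib, Finset.sum_add_distrib, ← Finset.sum_smul,
            ← Finset.smul_sum, hχgrad x hx, hχ1 x (subset_closure hx), one_smul, smul_zero, add_zero,
            gradient_fun_sum _ fun i _ => (hd _ (hφ i)) x]
      _ ≤ ∑ i, eLpNorm (fun x => gradient (φ i) x - (χ i x • G x + u x • gradient (χ i) x)) 2
          (volume.restrict Ω) :=
          eLpNorm_sum_le (fun i _ => (hcg _ (hφ i)).sub
            (((hcm _ (hχ i)).smul hG.1).add (hu.1.smul (hcg _ (hχ i))))) (by norm_num)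
      _ ≤ ε := hsum _ hφ2

end IsLipschitzDomain

/-! ### Passage to the limit and small sublevel sets -/

theorem lintegral_enorm_sq_le {α E : Type*} [MeasurableSpace α] [NormedAddCommGroup E]
    {μ : Measure α} {f g : α → E} (hg : AEStronglyMeasurable g μ) :
    ∫⁻ x, ‖f x‖ₑ ^ 2 ∂μ ≤
      2 * eLpNorm (fun x => f x - g x) 2 μ ^ 2 + 2 * ∫⁻ x, ‖g x‖ₑ ^ 2 ∂μ := by
  rw [eLpNorm_two_sq, ← lintegral_const_mul' _ _ (by simp), ← lintegral_const_mul' _ _ (by simp),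
    ← lintegral_add_right' _ ((hg.enorm.pow_const 2).const_mul 2)]
  refine lintegral_mono fun x => le_trans ?_ (ENNReal.add_sq_le_two_mul _ _)
  gcongr
  simpa using enorm_add_le (f x - g x) (g x)

section

variable {N : ℕ} {Ω : Set (RN N)} {u g : RN N → ℝ} {G : RN N → RN N}

/-- A quadratic estimate on smooth functions passes to limits, up to a factor. -/
theorem lintegral_enorm_sq_le_of_tendsto {φ : ℕ → RN N → ℝ} {μ : Measure (RN N)} {η K : ℝ≥0∞}
    (hη : η ≠ ⊤) (hK : K ≠ ⊤) (hu : AEStronglyMeasurable u (volume.restrict Ω))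
    (hG : AEStronglyMeasurable G (volume.restrict Ω)) (hφ : ∀ n, Continuous (φ n))
    (hlim : Tendsto (fun n => eLpNorm (fun x => φ n x - u x) 2 (volume.restrict Ω)) atTop (𝓝 0))
    (hlimG : Tendsto (fun n => eLpNorm (fun x => gradient (φ n) x - G x) 2 (volume.restrict Ω))
      atTop (𝓝 0))
    (hlimg : Tendsto (fun n => eLpNorm (fun x => φ n x - g x) 2 μ) atTop (𝓝 0))
    (hest : ∀ n, ∫⁻ x, ‖φ n x‖ₑ ^ 2 ∂μ ≤
      η * (∫⁻ x in Ω, ‖gradient (φ n) x‖ₑ ^ 2) + K * ∫⁻ x in Ω, ‖φ n x‖ₑ ^ 2) :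
    ∫⁻ x, ‖g x‖ₑ ^ 2 ∂μ ≤
      4 * η * (∫⁻ x in Ω, ‖G x‖ₑ ^ 2) + 4 * K * ∫⁻ x in Ω, ‖u x‖ₑ ^ 2 := by
  set I := ∫⁻ x in Ω, ‖u x‖ₑ ^ 2
  set J := ∫⁻ x in Ω, ‖G x‖ₑ ^ 2
  have hsq : ∀ {a : ℕ → ℝ≥0∞}, Tendsto a atTop (𝓝 0) →
      Tendsto (fun n => 2 * a n ^ 2) atTop (𝓝 0) := by
    intro a ha
    simpa using ENNReal.Tendsto.const_mul (a := 2) (ENNReal.Tendsto.pow (n := 2) ha)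
      (Or.inr (by simp))
  -- The factor 4 arises from using (a + b)² ≤ 2a² + 2b² twice: from g to φ n, then from φ n and its
  -- gradient to u and G.
  have hlim' := (hsq hlimg).add (ENNReal.Tendsto.const_mul (a := 2)
    ((ENNReal.Tendsto.const_mul (a := η) ((hsq hlimG).add_const (2 * J)) (Or.inr hη)).add
      (ENNReal.Tendsto.const_mul (a := K) ((hsq hlim).add_const (2 * I)) (Or.inr hK)))
    (Or.inr (by simp)))
  refine (ge_of_tendsto' hlim' fun n => ?_).trans_eq (by ring)
  have h1 := lintegral_enorm_sq_le (f := g) (μ := μ) (hφ n).aestronglyMeasurable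
  rw [← eLpNorm_neg] at h1
  simp only [Pi.neg_def, neg_sub] at h1
  refine h1.trans ?_
  gcongr
  refine (hest n).trans ?_
  gcongr
  · exact lintegral_enorm_sq_le hG
  · exact lintegral_enorm_sq_le hu

end

/-- The sublevel sets of an almost everywhere positive function have small measure. -/
theorem exists_measure_setOf_le_lt {α : Type*} [MeasurableSpace α] {μ : Measure α}
    [IsFiniteMeasure μ] {f : α → ℝ} (hf : AEMeasurable f μ) (hpos : ∀ᵐ x ∂μ, 0 < f x)
    {δ : ℝ≥0∞} (hδ : δ ≠ 0) : ∃ s : ℝ, 0 < s ∧ μ {x | f x ≤ s} < δ := by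
  have hanti : Antitone fun n : ℕ => {x | f x ≤ 1 / ((n : ℝ) + 1)} := fun m n hmn x hx =>
    le_trans (show f x ≤ _ from hx) (Nat.one_div_le_one_div hmn)
  have hlim := tendsto_measure_iInter_atTop (μ := μ)
    (fun n : ℕ => hf.nullMeasurable (measurableSet_Iic (a := 1 / ((n : ℝ) + 1)))) hanti
    ⟨0, measure_ne_top _ _⟩
  have hzero : μ (⋂ n : ℕ, {x | f x ≤ 1 / ((n : ℝ) + 1)}) = 0 := by
    refine measure_mono_null (fun x hx => ?_) (ae_iff.1 hpos)
    rw [Set.mem_iInter] at hx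
    exact not_lt.2 (ge_of_tendsto' tendsto_one_div_add_atTop_nhds_zero_nat hx)
  change Tendsto (fun n : ℕ => μ {x | f x ≤ 1 / ((n : ℝ) + 1)}) atTop (𝓝 (μ (⋂ n : ℕ,
    {x | f x ≤ 1 / ((n : ℝ) + 1)}))) at hlim
  rw [hzero] at hlim
  obtain ⟨n, hn⟩ := (hlim.eventually_lt_const (pos_iff_ne_zero.2 hδ)).exists
  exact ⟨1 / ((n : ℝ) + 1), by positivity, hn⟩

/-! ### Existence of the trace -/

namespace IsLipschitzDomain

variable {N : ℕ} {Ω : Set (RN N)}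

/-- The trace estimate applied to φ n - φ m turns H¹ convergence into a Cauchy property in L²(∂Ω),
whose limit is the trace. The rate 2⁻ⁿ gives the summable bounds required for completeness. -/
theorem exists_isTrace (hΩ : IsLipschitzDomain Ω) (hbdd : Bornology.IsBounded Ω)
    {u : RN N → ℝ} (hu : MemH1 Ω u) : ∃ g, IsTrace Ω u g := by
  obtain ⟨hu2, G, hw, hG⟩ := hu
  obtain ⟨C, hC, htr⟩ := hΩ.exists_trace_le hbdd one_ne_zero
  choose φ hφ hφu hφG using fun n : ℕ =>
    hΩ.exists_smooth_approx hbdd hw hu2 hG (ε := (2⁻¹ : ℝ≥0∞) ^ n) (by simp)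
  have hφ1 : ∀ n, ContDiff ℝ 1 (φ n) := fun n => (hφ n).of_le (by simp)
  have hgeom : Tendsto (fun n : ℕ => (2⁻¹ : ℝ≥0∞) ^ n) atTop (𝓝 0) :=
    ENNReal.tendsto_pow_atTop_nhds_zero_of_lt_one (by simp)
  have hlim : Tendsto (fun n => eLpNorm (fun x => φ n x - u x) 2 (volume.restrict Ω)) atTop (𝓝 0) :=
    tendsto_of_tendsto_of_tendsto_of_le_of_le tendsto_const_nhds hgeom (fun _ => zero_le) hφu
  have hlimG : Tendsto (fun n => eLpNorm (fun x => gradient (φ n) x - G x) 2 (volume.restrict Ω))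
      atTop (𝓝 0) :=
    tendsto_of_tendsto_of_tendsto_of_le_of_le tendsto_const_nhds hgeom (fun _ => zero_le) hφG
  have hcm : ∀ n, AEStronglyMeasurable (φ n) (volume.restrict Ω) := fun n =>
    (hφ n).continuous.aestronglyMeasurable
  have hgm : ∀ n, AEStronglyMeasurable (gradient (φ n)) (volume.restrict Ω) := fun n =>
    (hφ1 n).continuous_gradient.aestronglyMeasurable
  have hmem : ∀ n, MemLp (φ n) 2 (surfaceMeasure Ω) := by
    intro n
    refine ⟨(hφ n).continuous.aestronglyMeasurable, ?_⟩
    have hpow : ((2⁻¹ : ℝ≥0∞) ^ n) ^ 2 < ⊤ := by simp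
    have h1 : ∫⁻ x in Ω, ‖φ n x‖ₑ ^ 2 < ⊤ := by
      refine (lintegral_enorm_sq_le hu2.1).trans_lt (ENNReal.add_lt_top.2
        ⟨ENNReal.mul_lt_top (by simp) (lt_of_le_of_lt (by gcongr; exact hφu n) hpow),
          ENNReal.mul_lt_top (by simp) ?_⟩)
      rw [← eLpNorm_two_sq]
      exact ENNReal.pow_lt_top hu2.2
    have h2 : ∫⁻ x in Ω, ‖gradient (φ n) x‖ₑ ^ 2 < ⊤ := by
      refine (lintegral_enorm_sq_le hG.1).trans_lt (ENNReal.add_lt_top.2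
        ⟨ENNReal.mul_lt_top (by simp) (lt_of_le_of_lt (by gcongr; exact hφG n) hpow),
          ENNReal.mul_lt_top (by simp) ?_⟩)
      rw [← eLpNorm_two_sq]
      exact ENNReal.pow_lt_top hG.2
    have h3 : eLpNorm (φ n) 2 (surfaceMeasure Ω) ^ 2 < ⊤ := by
      rw [eLpNorm_two_sq]
      exact (htr _ (hφ1 n)).trans_lt (ENNReal.add_lt_top.2
        ⟨ENNReal.mul_lt_top (by simp) h2, ENNReal.mul_lt_top hC.lt_top h1⟩)
    exact (ENNReal.pow_lt_top_iff.1 h3).resolve_right two_ne_zero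
  have hcauchy : ∀ k n m : ℕ, k ≤ n → k ≤ m →
      eLpNorm (φ n - φ m) 2 (surfaceMeasure Ω) ≤ 2 * (1 + C) * (2⁻¹ : ℝ≥0∞) ^ k := by
    intro k n m hn hm
    have hpow : ∀ {i : ℕ}, k ≤ i → (2⁻¹ : ℝ≥0∞) ^ i ≤ 2⁻¹ ^ k := fun hi =>
      pow_le_pow_right_of_le_one' (by simp) hi
    set q := (2⁻¹ : ℝ≥0∞) ^ k
    have h1 : eLpNorm (fun x => φ n x - φ m x) 2 (volume.restrict Ω) ≤ 2 * q := by
      calc _ = eLpNorm ((fun x => φ n x - u x) - fun x => φ m x - u x) 2 (volume.restrict Ω) := by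
            congr 1 with x; simp
        _ ≤ _ := eLpNorm_sub_le ((hcm n).sub hu2.1) ((hcm m).sub hu2.1) (by norm_num)
        _ ≤ q + q := add_le_add ((hφu n).trans (hpow hn)) ((hφu m).trans (hpow hm))
        _ = 2 * q := by ring
    have h2 : eLpNorm (fun x => gradient (φ n - φ m) x) 2 (volume.restrict Ω) ≤ 2 * q := by
      calc _ = eLpNorm ((fun x => gradient (φ n) x - G x) - fun x => gradient (φ m) x - G x) 2
            (volume.restrict Ω) := by
            congr 1 with x : 1
            have : fderiv ℝ (φ n - φ m) x = fderiv ℝ (φ n) x - fderiv ℝ (φ m) x :=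
              fderiv_sub ((hφ1 n).differentiable one_ne_zero _)
                ((hφ1 m).differentiable one_ne_zero _)
            simp [gradient, this]
        _ ≤ _ := eLpNorm_sub_le ((hgm n).sub hG.1) ((hgm m).sub hG.1) (by norm_num)
        _ ≤ q + q := add_le_add ((hφG n).trans (hpow hn)) ((hφG m).trans (hpow hm))
        _ = 2 * q := by ring
    refine (ENNReal.pow_le_pow_left_iff two_ne_zero).1 ?_
    rw [eLpNorm_two_sq]
    refine (htr (φ n - φ m) ((hφ1 n).sub (hφ1 m))).trans ?_
    rw [← eLpNorm_two_sq, ← eLpNorm_two_sq]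
    calc _ ≤ 1 * (2 * q) ^ 2 + C * (2 * q) ^ 2 := by gcongr; exact h1
      _ = (1 + C) * (2 * q) ^ 2 := by ring
      -- Enlarging 1 + C to its square makes the bound a perfect square.
      _ ≤ (1 + C) ^ 2 * (2 * q) ^ 2 := by
        gcongr
        exact le_self_pow₀ le_self_add two_ne_zero
      _ = (2 * (1 + C) * q) ^ 2 := by ring
  have hC4 : 4 * (1 + C) ≠ ⊤ := ENNReal.mul_ne_top (by simp) (by simp [hC])
  obtain ⟨g, hg, hgl⟩ := Lp.cauchy_complete_eLpNorm (by norm_num) hmem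
    -- The factor 4, where 2 was proved, supplies the strict inequality.
    (B := fun k => 4 * (1 + C) * (2⁻¹ : ℝ≥0∞) ^ k)
    (by
      rw [ENNReal.tsum_mul_left, ENNReal.tsum_geometric]
      exact ENNReal.mul_ne_top hC4 (by simp))
    fun k n m hn hm => by
      refine (hcauchy k n m hn hm).trans_lt ?_
      refine ENNReal.mul_lt_mul_left (by simp) (by simp) ?_
      refine ENNReal.mul_lt_mul_left (by simp) (by simp [hC]) ?_
      norm_num
  exact ⟨g, hg, G, φ, hw, hφ, hlim, hlimG, hgl⟩

end IsLipschitzDomain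

/-! ### The two estimates in H¹ and the absorption -/

namespace IsLipschitzDomain

variable {N : ℕ} {Ω : Set (RN N)}

theorem lintegral_isTrace_sq_le (hΩ : IsLipschitzDomain Ω) (hbdd : Bornology.IsBounded Ω)
    {η : ℝ≥0∞} (hη : η ≠ 0) (hη' : η ≠ ⊤) :
    ∃ C : ℝ≥0∞, C ≠ ⊤ ∧ ∀ (u g : RN N → ℝ) (G : RN N → RN N), MemLp u 2 (volume.restrict Ω) →
      HasWeakGradient Ω u G → IsTrace Ω u g →
      ∫⁻ x, ‖g x‖ₑ ^ 2 ∂(surfaceMeasure Ω) ≤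
        η * (∫⁻ x in Ω, ‖G x‖ₑ ^ 2) + C * ∫⁻ x in Ω, ‖u x‖ₑ ^ 2 := by
  -- Division by 4 compensates for the factor lost in the limit.
  obtain ⟨C, hC, h⟩ := hΩ.exists_trace_le hbdd (η := η / 4) (by simpa using hη)
  refine ⟨4 * C, ENNReal.mul_ne_top (by simp) hC, fun u g G hu hw hg => ?_⟩
  obtain ⟨-, G', φ, hw', hφ, h1, h2, h3⟩ := hg
  have hae := hw.ae_eq hΩ.isOpen hw'
  have hGm : AEStronglyMeasurable G' (volume.restrict Ω) :=
    hw'.locallyIntegrable_grad.aestronglyMeasurable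
  have key := lintegral_enorm_sq_le_of_tendsto (η := η / 4) (ENNReal.div_ne_top hη' (by simp)) hC hu.1 hGm
    (fun n => (hφ n).continuous) h1 h2 h3 fun n => h _ ((hφ n).of_le (by simp))
  have hJ : ∫⁻ x in Ω, ‖G x‖ₑ ^ 2 = ∫⁻ x in Ω, ‖G' x‖ₑ ^ 2 :=
    lintegral_congr_ae (hae.fun_comp fun v => ‖v‖ₑ ^ 2)
  rw [hJ]
  rwa [ENNReal.mul_div_cancel (by simp) (by simp)] at key

theorem lintegral_inter_sq_le (hΩ : IsLipschitzDomain Ω) (hbdd : Bornology.IsBounded Ω)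
    {η : ℝ≥0∞} (hη : η ≠ 0) (hη' : η ≠ ⊤) :
    ∃ δ : ℝ≥0∞, δ ≠ 0 ∧ ∀ (u : RN N → ℝ) (G : RN N → RN N) (B : Set (RN N)),
      MemLp u 2 (volume.restrict Ω) → HasWeakGradient Ω u G →
      MemLp G 2 (volume.restrict Ω) → volume (B ∩ Ω) ≤ δ →
      ∫⁻ x in B ∩ Ω, ‖u x‖ₑ ^ 2 ≤
        η * (∫⁻ x in Ω, ‖G x‖ₑ ^ 2) + 2⁻¹ * ∫⁻ x in Ω, ‖u x‖ₑ ^ 2 := by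
  obtain ⟨C, hC, h⟩ := hΩ.exists_uniform_integrability hbdd (η := η / 4) (by simpa using hη)
  have hC1 : C + 1 ≠ ⊤ := by simp [hC]
  -- With this δ, 4 C |B ∩ Ω| ≤ 4/8 = 1/2; C + 1 is nonzero and can be cancelled.
  refine ⟨(8 * (C + 1))⁻¹, by simpa using ENNReal.mul_ne_top (by simp) hC1,
    fun u G B hu hw hG hB => ?_⟩
  have hgeom : Tendsto (fun n : ℕ => (2⁻¹ : ℝ≥0∞) ^ n) atTop (𝓝 0) :=
    ENNReal.tendsto_pow_atTop_nhds_zero_of_lt_one (by simp)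
  choose φ hφ hφu hφG using fun n : ℕ =>
    hΩ.exists_smooth_approx hbdd hw hu hG (ε := (2⁻¹ : ℝ≥0∞) ^ n) (by simp)
  have hlim : Tendsto (fun n => eLpNorm (fun x => φ n x - u x) 2 (volume.restrict Ω)) atTop (𝓝 0) :=
    tendsto_of_tendsto_of_tendsto_of_le_of_le tendsto_const_nhds hgeom (fun _ => zero_le) hφu
  have hlimG : Tendsto (fun n => eLpNorm (fun x => gradient (φ n) x - G x) 2 (volume.restrict Ω))
      atTop (𝓝 0) :=
    tendsto_of_tendsto_of_tendsto_of_le_of_le tendsto_const_nhds hgeom (fun _ => zero_le) hφG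
  have hlimB : Tendsto (fun n => eLpNorm (fun x => φ n x - u x) 2 (volume.restrict (B ∩ Ω)))
      atTop (𝓝 0) :=
    tendsto_of_tendsto_of_tendsto_of_le_of_le tendsto_const_nhds hlim (fun _ => zero_le) fun n =>
      eLpNorm_mono_measure _ (Measure.restrict_mono Set.inter_subset_right le_rfl)
  have hCB : 4 * (C * volume (B ∩ Ω)) ≤ 2⁻¹ := by
    calc 4 * (C * volume (B ∩ Ω)) ≤ 4 * ((C + 1) * (8 * (C + 1))⁻¹) := by
          gcongr
          exact le_self_add
      _ = 4 * 8⁻¹ * ((C + 1) * (C + 1)⁻¹) := by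
          rw [ENNReal.mul_inv (by simp) (by simp)]; ring
      _ = 4 * 8⁻¹ := by rw [ENNReal.mul_inv_cancel (by simp) hC1, mul_one]
      _ = 2⁻¹ := by
        rw [show (8 : ℝ≥0∞) = 4 * 2 by norm_num, ENNReal.mul_inv (by simp) (by simp), ← mul_assoc,
          ENNReal.mul_inv_cancel (by simp) (by simp), one_mul]
  have hKtop : C * volume (B ∩ Ω) ≠ ⊤ :=
    ENNReal.mul_ne_top hC ((measure_mono Set.inter_subset_right).trans_lt hbdd.measure_lt_top).ne
  have key := lintegral_enorm_sq_le_of_tendsto (η := η / 4) (ENNReal.div_ne_top hη' (by simp)) hKtop hu.1 hG.1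
    (fun n => (hφ n).continuous) hlim hlimG hlimB fun n => by
      have := h _ ((hφ n).of_le (by simp)) (B ∩ Ω)
      rwa [Set.inter_assoc, Set.inter_self] at this
  have hη4 : 4 * (η / 4) = η := ENNReal.mul_div_cancel (by simp) (by simp)
  rw [hη4] at key
  refine key.trans ?_
  gcongr

/-- The `L²` norm is controlled by a small multiple of the gradient and the weighted norm. -/
theorem lintegral_sq_le_weighted (hΩ : IsLipschitzDomain Ω) (hbdd : Bornology.IsBounded Ω)
    {f : RN N → ℝ} (hf : AEMeasurable f (volume.restrict Ω))
    (hfpos : ∀ᵐ x ∂(volume.restrict Ω), 0 < f x) {η : ℝ≥0∞} (hη : η ≠ 0) (hη' : η ≠ ⊤) :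
    ∃ C : ℝ≥0∞, C ≠ ⊤ ∧ ∀ (u : RN N → ℝ) (G : RN N → RN N), MemLp u 2 (volume.restrict Ω) →
      HasWeakGradient Ω u G → MemLp G 2 (volume.restrict Ω) →
      ∫⁻ x in Ω, ‖u x‖ₑ ^ 2 ≤
        η * (∫⁻ x in Ω, ‖G x‖ₑ ^ 2) + C * ∫⁻ x in Ω, ENNReal.ofReal (u x ^ 2 * f x) := by
  have : IsFiniteMeasure (volume.restrict Ω) := ⟨by simpa using hbdd.measure_lt_top⟩
  obtain ⟨δ, hδ, h⟩ := hΩ.lintegral_inter_sq_le hbdd (η := η / 2) (by simpa using hη)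
    (ENNReal.div_ne_top hη' (by simp))
  obtain ⟨s, hs, hsδ⟩ := exists_measure_setOf_le_lt hf hfpos hδ
  refine ⟨2 * ENNReal.ofReal s⁻¹, ENNReal.mul_ne_top (by simp) (by simp), fun u G hu hw hG => ?_⟩
  set B := {x | f x ≤ s} with hB
  have hBm : NullMeasurableSet B (volume.restrict Ω) := hf.nullMeasurable measurableSet_Iic
  have hBδ : volume (B ∩ Ω) ≤ δ := (Measure.le_restrict_apply _ _).trans hsδ.le
  set I := ∫⁻ x in Ω, ‖u x‖ₑ ^ 2 with hI
  set J := ∫⁻ x in Ω, ‖G x‖ₑ ^ 2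
  set Q := ∫⁻ x in Ω, ENNReal.ofReal (u x ^ 2 * f x)
  -- Finiteness of I allows half of it to be subtracted below.
  have hItop : I ≠ ⊤ := by
    rw [hI, ← eLpNorm_two_sq]
    exact (ENNReal.pow_lt_top hu.2).ne
  -- Where f > s, the weight dominates: u² ≤ s⁻¹ f u².
  have hpt : ∀ x, ‖u x‖ₑ ^ 2 ≤ B.indicator (fun x => ‖u x‖ₑ ^ 2) x +
      ENNReal.ofReal s⁻¹ * ENNReal.ofReal (u x ^ 2 * f x) := by
    intro x
    by_cases hx : x ∈ B
    · rw [Set.indicator_of_mem hx]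
      exact le_self_add
    · rw [Set.indicator_of_notMem hx, zero_add, ← ENNReal.ofReal_mul (by positivity),
        Real.enorm_eq_ofReal_abs, ← ENNReal.ofReal_pow (abs_nonneg _), sq_abs]
      apply ENNReal.ofReal_le_ofReal
      have hsx : s < f x := not_le.1 hx
      calc u x ^ 2 = s⁻¹ * (u x ^ 2 * s) := by field_simp
        _ ≤ s⁻¹ * (u x ^ 2 * f x) := by gcongr
  have hmain : I ≤ (η / 2 * J + 2⁻¹ * I) + ENNReal.ofReal s⁻¹ * Q := by
    have hQm : AEMeasurable (fun x => ENNReal.ofReal s⁻¹ * ENNReal.ofReal (u x ^ 2 * f x))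
        (volume.restrict Ω) :=
      (((hu.1.aemeasurable.pow_const 2).mul hf).ennreal_ofReal).const_mul _
    calc I ≤ _ := lintegral_mono hpt
      _ = (∫⁻ x in Ω, B.indicator (fun x => ‖u x‖ₑ ^ 2) x) + ENNReal.ofReal s⁻¹ * Q := by
        rw [lintegral_add_right' _ hQm, lintegral_const_mul' _ _ (by simp)]
      _ ≤ _ := by
        gcongr
        refine (lintegral_indicator_le _ _).trans ?_
        rw [Measure.restrict_restrict₀ hBm]
        exact h u G B hu hw hG hBδ
  have hhalf : 2⁻¹ * I + 2⁻¹ * I = I := by rw [← add_mul, ENNReal.inv_two_add_inv_two, one_mul]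
  have hcancel : 2⁻¹ * I ≤ η / 2 * J + ENNReal.ofReal s⁻¹ * Q := by
    have htop : 2⁻¹ * I ≠ ⊤ := ENNReal.mul_ne_top (by simp) hItop
    refine (ENNReal.add_le_add_iff_left htop).1 ?_
    calc 2⁻¹ * I + 2⁻¹ * I = I := hhalf
      _ ≤ _ := hmain
      _ = _ := by ring
  calc I = 2 * (2⁻¹ * I) := by rw [← mul_assoc, ENNReal.mul_inv_cancel (by simp) (by simp), one_mul]
    _ ≤ 2 * (η / 2 * J + ENNReal.ofReal s⁻¹ * Q) := by gcongr
    _ = 2 * (η / 2) * J + 2 * ENNReal.ofReal s⁻¹ * Q := by ring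
    _ = _ := by rw [ENNReal.mul_div_cancel (by simp) (by simp)]

end IsLipschitzDomain

/-! ### Combination of the estimates -/

theorem mainTheorem8 (N : ℕ) (hN : 1 ≤ N) (Ω : Set (RN N))
    (hbdd : Bornology.IsBounded Ω) (hΩ : IsLipschitzDomain Ω)
    (f : RN N → ℝ) (hf : IntegrableOn f Ω volume)
    (hfpos : ∀ᵐ x ∂(volume.restrict Ω), 0 < f x) :
    ∀ ε : ℝ, 0 < ε → ∃ C : ℝ, 0 < C ∧ ∀ u : RN N → ℝ, MemH1 Ω u →
      (∃ g : RN N → ℝ, IsTrace Ω u g) ∧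
      ∀ (G : RN N → RN N) (g : RN N → ℝ), HasWeakGradient Ω u G → IsTrace Ω u g →
        (∫⁻ x, ENNReal.ofReal (g x ^ 2) ∂(surfaceMeasure Ω)) ≤
          ENNReal.ofReal ε * (∫⁻ x in Ω, ENNReal.ofReal (‖G x‖ ^ 2)) +
          ENNReal.ofReal C * (∫⁻ x in Ω, ENNReal.ofReal (u x ^ 2 * f x)) := by
  intro ε hε
  set E := ENNReal.ofReal ε
  have hE0 : E ≠ 0 := by simpa [E] using hε
  have hEtop : E ≠ ⊤ := ENNReal.ofReal_ne_top
  obtain ⟨C₁, hC₁, h₁⟩ := hΩ.lintegral_isTrace_sq_le hbdd (η := E / 2) (by simpa using hE0)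
    (ENNReal.div_ne_top hEtop (by simp))
  have hC₁' : C₁ + 1 ≠ ⊤ := by simp [hC₁]
  -- This η, multiplied by C₁, is at most ε / 2: half of ε for each estimate.
  obtain ⟨C₂, hC₂, h₂⟩ := hΩ.lintegral_sq_le_weighted hbdd hf.aemeasurable hfpos
    (η := E / 2 / (C₁ + 1)) (ENNReal.div_pos (by simpa using hE0) hC₁').ne'
    (ENNReal.div_ne_top (ENNReal.div_ne_top hEtop (by simp)) (by simp))
  have hC : C₁ * C₂ ≠ ⊤ := ENNReal.mul_ne_top hC₁ hC₂
  refine ⟨(C₁ * C₂).toReal + 1, by positivity, fun u hu => ⟨hΩ.exists_isTrace hbdd hu, ?_⟩⟩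
  intro G g hw hg
  obtain ⟨hu2, G', hw', hG'⟩ := hu
  -- The given G is only a weak gradient; uniqueness transfers square integrability from the one in
  -- `MemH1`.
  have hG : MemLp G 2 (volume.restrict Ω) := hG'.ae_eq (hw'.ae_eq hΩ.isOpen hw)
  have e1 : ∀ a : ℝ, ENNReal.ofReal (a ^ 2) = ‖a‖ₑ ^ 2 := fun a => by
    rw [Real.enorm_eq_ofReal_abs, ← ENNReal.ofReal_pow (abs_nonneg _), sq_abs]
  have e2 : ∀ a : RN N, ENNReal.ofReal (‖a‖ ^ 2) = ‖a‖ₑ ^ 2 := fun a => by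
    rw [ENNReal.ofReal_pow (norm_nonneg _), ofReal_norm]
  simp only [e2]
  simp only [e1]
  set J := ∫⁻ x in Ω, ‖G x‖ₑ ^ 2
  set Q := ∫⁻ x in Ω, ENNReal.ofReal (u x ^ 2 * f x)
  calc ∫⁻ x, ‖g x‖ₑ ^ 2 ∂(surfaceMeasure Ω)
      ≤ E / 2 * J + C₁ * ∫⁻ x in Ω, ‖u x‖ₑ ^ 2 := h₁ u g G hu2 hw hg
    _ ≤ E / 2 * J + C₁ * (E / 2 / (C₁ + 1) * J + C₂ * Q) := by
        gcongr
        exact h₂ u G hu2 hw hG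
    _ = E / 2 * J + C₁ * (E / 2 / (C₁ + 1)) * J + C₁ * C₂ * Q := by ring
    _ ≤ E / 2 * J + E / 2 * J + ENNReal.ofReal ((C₁ * C₂).toReal + 1) * Q := by
        gcongr
        · calc C₁ * (E / 2 / (C₁ + 1)) ≤ (C₁ + 1) * (E / 2 / (C₁ + 1)) := by
                gcongr
                exact le_self_add
            _ ≤ E / 2 := ENNReal.mul_div_le
        · calc C₁ * C₂ = ENNReal.ofReal (C₁ * C₂).toReal := (ENNReal.ofReal_toReal hC).symm
            _ ≤ _ := ENNReal.ofReal_le_ofReal (by linarith)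
    _ = E * J + ENNReal.ofReal ((C₁ * C₂).toReal + 1) * Q := by
        rw [← add_mul, ENNReal.add_halves]
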